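/- Let $k$ be an algebraically closed field, $G$ a finite group scheme over $k$ with (finite dimensional, commutative) Hopf algebra $R=k[G]$, and let $G$ act from the right on an irreducible affine algebraic variety $X$ over $k$, with algebra $A=k[X]$ and comorphism $\mu^*:A\to A\otimes_k R$. Put $A^G=\{a\in A\mid \mu^*(a)=a\otimes 1\}$. For $x\in X(k)$ let $G_x\subset G$ be the stabilizer of $x$, i.e. the subgroup scheme with $G_x(K)=\{g\in G(K)\mid x_Kg=x_K\}$ for all commutative $k$-algebras $K$, and let $(G:G_x)=\dim_k k[G_x\backslash G]$ be its index, where $k[G_x\backslash G]=k[G]^{G_x}$ is the algebra of functions on $G$ invariant under left translations by $G_x$. Call $x$ $G$-regular if $(G:G_x)$ attains the maximal value $\max_{y\in X(k)}(G:G_y)$. An $(A,G)$-module is an $A$-module $M$ equipped with a $G$-module structure (an $R$-comodule structure $\mu^M:M\to M\otimes_k R$) such that the map $M\otimes_k A\to M$ is $G$-equivariant, i.e. $\mu^M(ma)=\mu^M(m)\cdot\mu^*(a)$; morphisms of $(A,G)$-modules are the $A$-linear $G$-equivariant maps. Put $M^G=\{m\in M\mid \mu^M(m)=m\otimes 1\}$,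 which is an $A^G$-module. Let $\mathcal M'_A$ be the full subcategory of the category of $(A,G)$-modules consisting of those $M$ with $M=M^GA$. Suppose that all points $x\in X(k)$ are $G$-regular. Then: (1) $\mathcal M'_A$ is closed under taking $(A,G)$-submodules and $(A,G)$-factor modules. (2) The functor $M\mapsto M^G$ is an equivalence between $\mathcal M'_A$ and the category of $A^G$-modules. The inverse functor is $N\mapsto N\otimes_{A^G}A$, where $G$ acts through the second factor. (3) If $M\in\mathcal M'_A$ is (finitely generated) projective of constant rank $r$ as an $A$-module, then $M^G$ is (finitely generated) projective of constant rank $r$ as an $A^G$-module. -/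

import Mathlib

open scoped TensorProduct
open CategoryTheory

namespace GroupSchemeAction

universe w v u₁ u₂ u₃

noncomputable section

section Comodule

variable {k : Type u₁} {R : Type u₂} [Field k] [CommRing R] [HopfAlgebra k R]

/-- A `k`-linear map `ρ : M → M ⊗ R` is a (right) comodule structure over `R = k[G]`,
i.e. a representation of the affine group scheme `G` on `M`. -/
structure IsComodule {M : Type w} [AddCommGroup M] [Module k M] (ρ : M →ₗ[k] M ⊗[k] R) :
    Prop where
  coassoc : TensorProduct.assoc k M R R ∘ₗ ρ.rTensor R ∘ₗ ρ =
    (Coalgebra.comul (R := k) (A := R)).lTensor M ∘ₗ ρ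
  counit : TensorProduct.rid k M ∘ₗ (Coalgebra.counit (R := k) (A := R)).lTensor M ∘ₗ ρ =
    LinearMap.id

end Comodule

/-- A right action `X × G → X` of the affine group scheme `G = Spec R` on the affine scheme
`X = Spec A`, given by its comorphism `A → A ⊗ R`. -/
structure Action (k : Type u₁) (R : Type u₂) (A : Type u₃) [Field k] [CommRing R]
    [HopfAlgebra k R] [CommRing A] [Algebra k A] where
  coact : A →ₐ[k] A ⊗[k] R
  isComodule : IsComodule coact.toLinearMap

variable {k : Type u₁} {R : Type u₂} {A : Type u₃} [Field k] [CommRing R] [HopfAlgebra k R]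
  [CommRing A] [Algebra k A]

section Stabilizers

/-- For the closed subscheme `H ⊆ G` with ideal `I ⊆ R = k[G]`, the algebra `k[H\G] = k[G]^H` of
functions on `G` invariant under left translations by `H`, i.e. of those `f` such that the
restriction of `(h, g) ↦ f (h g)` to `H × G` is `(h, g) ↦ f g`. -/
def leftInvariants (I : Ideal R) : Subalgebra k R :=
  AlgHom.equalizer
    ((Algebra.TensorProduct.map (Ideal.Quotient.mkₐ k I) (AlgHom.id k R)).comp
      (Bialgebra.comulAlgHom k R))
    (Algebra.TensorProduct.includeRight : R →ₐ[k] (R ⧸ I) ⊗[k] R)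

/-- The index `(G : H) = dim k[H\G]`. -/
def index (k : Type u₁) {R : Type u₂} [Field k] [CommRing R] [HopfAlgebra k R]
    (I : Ideal R) : ℕ :=
  Module.finrank k (leftInvariants (k := k) I)

variable (μ : Action k R A)

/-- The translate `x_K g ∈ X(K)` of the rational point `x ∈ X(k)` by `g ∈ G(K)`. -/
def Action.translate (x : A →ₐ[k] k) {K : Type w} [CommRing K] [Algebra k K] (g : R →ₐ[k] K) :
    A →ₐ[k] K :=
  (Algebra.TensorProduct.lift ((Algebra.ofId k K).comp x) g (fun _ _ => Commute.all _ _)).comp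
    μ.coact

/-- The comorphism `A → R` of the orbit morphism `G → X`, `g ↦ x g`. -/
def Action.orbitMap (x : A →ₐ[k] k) : A →ₐ[k] R :=
  μ.translate x (AlgHom.id k R)

/-- The ideal of `k[G]` which defines the stabilizer `G_x`: it is the ideal of the fibre above `x`
of the orbit morphism of `x`. -/
def Action.stabilizerIdeal (x : A →ₐ[k] k) : Ideal R :=
  (RingHom.ker x).map (μ.orbitMap x)

theorem Action.comp_orbitMap (x : A →ₐ[k] k) {K : Type w} [CommRing K] [Algebra k K]
    (g : R →ₐ[k] K) : g.comp (μ.orbitMap x) = μ.translate x g := by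
  unfold Action.orbitMap Action.translate
  rw [← AlgHom.comp_assoc]
  congr 1
  ext a
  · simp [Algebra.ofId_apply]
  · simp

/-- `G_x(K) = {g ∈ G(K) | x_K g = x_K}`. -/
theorem Action.stabilizerIdeal_le_ker_iff (x : A →ₐ[k] k) {K : Type w} [CommRing K] [Algebra k K]
    (g : R →ₐ[k] K) :
    μ.stabilizerIdeal x ≤ RingHom.ker g ↔ μ.translate x g = (Algebra.ofId k K).comp x := by
  rw [← μ.comp_orbitMap, stabilizerIdeal, Ideal.map_le_iff_le_comap]
  constructor
  · intro h
    ext a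
    have h1 : a - algebraMap k A (x a) ∈ RingHom.ker x := by simp [RingHom.mem_ker]
    have h2 := h h1
    simpa [RingHom.mem_ker, sub_eq_zero, Algebra.ofId_apply] using h2
  · intro h a ha
    have h1 := DFunLike.congr_fun h a
    rw [RingHom.mem_ker] at ha
    simpa [RingHom.mem_ker, ha] using h1

/-- The rational point `x` is `G`-regular: the index `(G : G_x)` attains the maximal value. -/
def Action.IsRegularPoint (x : A →ₐ[k] k) : Prop :=
  ∀ y : A →ₐ[k] k, index k (μ.stabilizerIdeal y) ≤ index k (μ.stabilizerIdeal x)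

/-- The algebra of invariants `A^G`. -/
def Action.invariants : Subalgebra k A :=
  AlgHom.equalizer μ.coact Algebra.TensorProduct.includeLeft

end Stabilizers

section Modules

/-- The action of `A ⊗ R` on `M ⊗ R`: `(a ⊗ r) • (m ⊗ s) = a m ⊗ r s`. -/
def tensorSMul (M : Type w) [AddCommGroup M] [Module k M] [Module A M] [IsScalarTower k A M] :
    A ⊗[k] R →ₗ[k] M ⊗[k] R →ₗ[k] M ⊗[k] R :=
  TensorProduct.map₂ (Algebra.lsmul k k M).toLinearMap (LinearMap.mul k R)

@[simp] theorem tensorSMul_tmul (M : Type w) [AddCommGroup M] [Module k M] [Module A M]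
    [IsScalarTower k A M] (a : A) (r s : R) (m : M) :
    tensorSMul M (a ⊗ₜ[k] r) (m ⊗ₜ[k] s) = (a • m) ⊗ₜ[k] (r * s) := rfl

/-- An `(A, G)`-module: an `A`-module with a structure of a `G`-module for which `M ⊗ A → M` is
`G`-equivariant. (As `A` is commutative, the scalars are written on the left.) -/
structure AGModule (μ : Action k R A) : Type (max u₁ u₂ u₃ (w + 1)) where
  carrier : Type w
  [addCommGroup : AddCommGroup carrier]
  [moduleBase : Module k carrier]
  [module : Module A carrier]
  [isScalarTower : IsScalarTower k A carrier]
  coact : carrier →ₗ[k] carrier ⊗[k] R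
  isComodule : IsComodule coact
  coact_smul : ∀ (a : A) (m : carrier),
    coact (a • m) = tensorSMul carrier (μ.coact a) (coact m)

attribute [instance] AGModule.addCommGroup AGModule.moduleBase AGModule.module
  AGModule.isScalarTower

variable {μ : Action k R A}

instance : CoeSort (AGModule.{w} μ) (Type w) := ⟨AGModule.carrier⟩

/-- A morphism of `(A, G)`-modules: an `A`-linear and `G`-equivariant map. -/
@[ext]
structure AGModule.Hom (M N : AGModule.{w} μ) where
  toLinearMap : M →ₗ[A] N
  equivariant : N.coact ∘ₗ toLinearMap.restrictScalars k =
    (toLinearMap.restrictScalars k).rTensor R ∘ₗ M.coact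

theorem AGModule.Hom.coact_apply {M N : AGModule.{w} μ} (f : AGModule.Hom M N) (m : M) :
    N.coact (f.toLinearMap m) = (f.toLinearMap.restrictScalars k).rTensor R (M.coact m) :=
  LinearMap.congr_fun f.equivariant m

instance : Category (AGModule.{w} μ) where
  Hom := AGModule.Hom
  id M := ⟨LinearMap.id, by
    ext m
    change M.coact m = LinearMap.rTensor R (LinearMap.id : M →ₗ[k] M) (M.coact m)
    simp⟩
  comp {M N P} f g := ⟨g.toLinearMap ∘ₗ f.toLinearMap, by
    ext m
    change P.coact (g.toLinearMap (f.toLinearMap m)) = LinearMap.rTensor R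
      (g.toLinearMap.restrictScalars k ∘ₗ f.toLinearMap.restrictScalars k) (M.coact m)
    rw [g.coact_apply, f.coact_apply, LinearMap.rTensor_comp_apply]⟩

/-- The `A^G`-module `M^G` of invariants of an `(A, G)`-module `M`. -/
def AGModule.invariants (M : AGModule.{w} μ) : Submodule μ.invariants M where
  carrier := {m | M.coact m = m ⊗ₜ[k] (1 : R)}
  add_mem' {m n} hm hn := by
    simp only [Set.mem_ofPred_eq] at hm hn ⊢
    rw [map_add, hm, hn, TensorProduct.add_tmul]
  zero_mem' := by simp
  smul_mem' a m hm := by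
    have ha : μ.coact (a : A) = (a : A) ⊗ₜ[k] (1 : R) := a.2
    simp only [Set.mem_ofPred_eq] at hm ⊢
    rw [Subalgebra.smul_def, M.coact_smul, ha, hm, tensorSMul_tmul, mul_one]

theorem AGModule.mem_invariants {M : AGModule.{w} μ} {m : M} :
    m ∈ M.invariants ↔ M.coact m = m ⊗ₜ[k] (1 : R) := Iff.rfl

/-- The functor `M ↦ M^G` from `(A, G)`-modules to `A^G`-modules. -/
def invariantsFunctor (μ : Action k R A) : AGModule.{w} μ ⥤ ModuleCat.{w} μ.invariants where
  obj M := ModuleCat.of μ.invariants M.invariants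
  map {M N} f := ModuleCat.ofHom
    ((f.toLinearMap.restrictScalars μ.invariants).restrict (fun m hm => by
      rw [AGModule.mem_invariants] at hm ⊢
      change N.coact (f.toLinearMap m) = f.toLinearMap m ⊗ₜ[k] (1 : R)
      rw [f.coact_apply, hm]
      rfl))

/-- The `(A, G)`-modules `M` such that `M = M^G A`. The corresponding full subcategory is the
category `𝓜'_A`. -/
def generatedByInvariants (μ : Action k R A) : ObjectProperty (AGModule.{w} μ) :=
  fun M => Submodule.span A (M.invariants : Set M) = ⊤

end Modules

section Extension

variable (μ : Action k R A)

/-- The comorphism `A → A ⊗ R` of the action as an `A^G`-linear map. -/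
def Action.coactLinear : A →ₗ[μ.invariants] A ⊗[k] R where
  toFun := μ.coact
  map_add' := map_add _
  map_smul' a b := by
    have ha : μ.coact (a : A) = (a : A) ⊗ₜ[k] (1 : R) := a.2
    rw [Subalgebra.smul_def, smul_eq_mul, map_mul, ha, RingHom.id_apply]
    induction μ.coact b using TensorProduct.induction_on with
    | zero => simp
    | tmul c r => simp [TensorProduct.smul_tmul', Subalgebra.smul_def]
    | add x y hx hy => rw [mul_add, hx, hy, smul_add]

variable (N : Type w) [AddCommGroup N] [Module μ.invariants N]

/-- The comodule structure on `A ⊗_{A^G} N` induced by the one of `A`. -/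
def Action.extendCoact : A ⊗[μ.invariants] N →ₗ[k] (A ⊗[μ.invariants] N) ⊗[k] R :=
  ((TensorProduct.AlgebraTensorModule.rightComm k μ.invariants μ.invariants A N R).symm.toLinearMap
    ∘ₗ μ.coactLinear.rTensor N).restrictScalars k

/-- The `k`-linear map `A → A ⊗_{A^G} N`, `a ↦ a ⊗ n`. -/
def Action.tmulRight (n : N) : A →ₗ[k] A ⊗[μ.invariants] N where
  toFun a := a ⊗ₜ n
  map_add' a b := TensorProduct.add_tmul a b n
  map_smul' c a := (TensorProduct.smul_tmul' c a n).symm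

@[simp] theorem Action.tmulRight_apply (n : N) (a : A) : μ.tmulRight N n a = a ⊗ₜ n := rfl

theorem Action.extendCoact_tmul (a : A) (n : N) :
    μ.extendCoact N (a ⊗ₜ n) = (μ.tmulRight N n).rTensor R (μ.coact a) := by
  change (TensorProduct.AlgebraTensorModule.rightComm k μ.invariants μ.invariants A N R).symm
    (μ.coact a ⊗ₜ n) = _
  induction μ.coact a using TensorProduct.induction_on with
  | zero => simp
  | tmul c r => rfl
  | add x y hx hy => rw [TensorProduct.add_tmul, map_add, hx, hy, map_add]

theorem Action.isComodule_extendCoact : IsComodule (μ.extendCoact N) where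
  coassoc := by
    refine LinearMap.ext fun t => ?_
    induction t using TensorProduct.induction_on with
    | zero => simp
    | add x y hx hy => rw [map_add, hx, hy, map_add]
    | tmul a n =>
      have h0 : μ.extendCoact N ∘ₗ μ.tmulRight N n =
          (μ.tmulRight N n).rTensor R ∘ₗ μ.coact.toLinearMap :=
        LinearMap.ext fun b => μ.extendCoact_tmul N b n
      have h1 : (TensorProduct.assoc k (A ⊗[μ.invariants] N) R R).toLinearMap ∘ₗ
          ((μ.tmulRight N n).rTensor R).rTensor R =
          (μ.tmulRight N n).rTensor (R ⊗[k] R) ∘ₗ (TensorProduct.assoc k A R R).toLinearMap :=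
        TensorProduct.ext_threefold fun _ _ _ => rfl
      have h2 := LinearMap.congr_fun μ.isComodule.coassoc a
      simp only [LinearMap.comp_apply, AlgHom.toLinearMap_apply, LinearEquiv.coe_coe] at h2 ⊢
      rw [μ.extendCoact_tmul, ← LinearMap.rTensor_comp_apply, h0, LinearMap.rTensor_comp_apply]
      have h3 := LinearMap.congr_fun h1 (μ.coact.toLinearMap.rTensor R (μ.coact a))
      simp only [LinearMap.comp_apply, LinearEquiv.coe_coe] at h3
      rw [h3, h2, ← LinearMap.comp_apply, ← LinearMap.comp_apply, LinearMap.rTensor_comp_lTensor,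
        LinearMap.lTensor_comp_rTensor]
  counit := by
    refine LinearMap.ext fun t => ?_
    induction t using TensorProduct.induction_on with
    | zero => simp
    | add x y hx hy => rw [map_add, hx, hy, map_add]
    | tmul a n =>
      have h1 : (TensorProduct.rid k (A ⊗[μ.invariants] N)).toLinearMap ∘ₗ
          (μ.tmulRight N n).rTensor k =
          μ.tmulRight N n ∘ₗ (TensorProduct.rid k A).toLinearMap :=
        TensorProduct.ext' fun b c => by simp
      have h2 := LinearMap.congr_fun μ.isComodule.counit a
      simp only [LinearMap.comp_apply, AlgHom.toLinearMap_apply, LinearEquiv.coe_coe,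
        LinearMap.id_apply] at h2 ⊢
      rw [μ.extendCoact_tmul, ← LinearMap.comp_apply, LinearMap.lTensor_comp_rTensor,
        ← LinearMap.rTensor_comp_lTensor, LinearMap.comp_apply]
      have h3 := LinearMap.congr_fun h1
        ((Coalgebra.counit (R := k) (A := R)).lTensor A (μ.coact a))
      simp only [LinearMap.comp_apply, LinearEquiv.coe_coe] at h3
      rw [h3, h2, μ.tmulRight_apply]

theorem Action.extendCoact_smul (a : A) (t : A ⊗[μ.invariants] N) :
    μ.extendCoact N (a • t) =
      tensorSMul (A ⊗[μ.invariants] N) (μ.coact a) (μ.extendCoact N t) := by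
  induction t using TensorProduct.induction_on with
  | zero => simp
  | add x y hx hy => rw [smul_add, map_add, hx, hy, map_add, map_add]
  | tmul b n =>
    rw [TensorProduct.smul_tmul', smul_eq_mul, μ.extendCoact_tmul, μ.extendCoact_tmul, map_mul]
    induction μ.coact a using TensorProduct.induction_on with
    | zero => simp
    | add x y hx hy => rw [add_mul, map_add, hx, hy, map_add, LinearMap.add_apply]
    | tmul c r =>
      induction μ.coact b using TensorProduct.induction_on with
      | zero => simp
      | add x y hx hy => rw [mul_add, map_add, hx, hy, map_add, map_add]
      | tmul d s => simp [TensorProduct.smul_tmul']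

/-- The `(A, G)`-module `N ⊗_{A^G} A` (written with the factors interchanged). -/
def Action.extend (N : Type (max v u₃)) [AddCommGroup N] [Module μ.invariants N] :
    AGModule.{max v u₃} μ where
  carrier := A ⊗[μ.invariants] N
  coact := μ.extendCoact N
  isComodule := μ.isComodule_extendCoact N
  coact_smul := μ.extendCoact_smul N

/-- The functor `N ↦ N ⊗_{A^G} A` from `A^G`-modules to `(A, G)`-modules. -/
def extensionFunctor : ModuleCat.{max v u₃} μ.invariants ⥤ AGModule.{max v u₃} μ where
  obj N := Action.extend.{v} μ N
  map {M N} f :=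
    { toLinearMap := TensorProduct.AlgebraTensorModule.lTensor A A f.hom
      equivariant := by
        refine LinearMap.ext fun t => ?_
        change μ.extendCoact N (TensorProduct.AlgebraTensorModule.lTensor A A f.hom t) =
          ((TensorProduct.AlgebraTensorModule.lTensor A A f.hom).restrictScalars k).rTensor R
            (μ.extendCoact M t)
        induction t using TensorProduct.induction_on with
        | zero => simp
        | add x y hx hy => simp only [map_add, hx, hy]
        | tmul a m =>
          rw [TensorProduct.AlgebraTensorModule.lTensor_tmul, μ.extendCoact_tmul,
            μ.extendCoact_tmul, ← LinearMap.rTensor_comp_apply]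
          rfl }
  map_id N := by
    apply AGModule.Hom.ext
    exact TensorProduct.AlgebraTensorModule.lTensor_id
  map_comp f g := by
    apply AGModule.Hom.ext
    exact TensorProduct.AlgebraTensorModule.lTensor_comp _ _

theorem generatedByInvariants_extend (N : ModuleCat.{max v u₃} μ.invariants) :
    generatedByInvariants μ ((extensionFunctor.{v} μ).obj N) := by
  refine (Submodule.eq_top_iff').2 fun (t : A ⊗[μ.invariants] N) => ?_
  induction t using TensorProduct.induction_on with
  | zero => exact Submodule.zero_mem _
  | add x y hx hy => exact Submodule.add_mem _ hx hy
  | tmul a n =>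
    have h : a ⊗ₜ[μ.invariants] n = a • ((1 : A) ⊗ₜ[μ.invariants] n) := by
      rw [TensorProduct.smul_tmul', smul_eq_mul, mul_one]
    rw [h]
    refine Submodule.smul_mem _ _ (Submodule.subset_span ?_)
    change μ.extendCoact N (1 ⊗ₜ n) = (1 ⊗ₜ n) ⊗ₜ (1 : R)
    rw [μ.extendCoact_tmul, map_one, Algebra.TensorProduct.one_def, LinearMap.rTensor_tmul,
      μ.tmulRight_apply]

/-- The functor `M ↦ M^G` from `𝓜'_A` to `A^G`-modules. -/
def invariantsFunctor' : (generatedByInvariants.{w} μ).FullSubcategory ⥤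
    ModuleCat.{w} μ.invariants :=
  (generatedByInvariants μ).ι ⋙ invariantsFunctor μ

/-- The functor `N ↦ N ⊗_{A^G} A` from `A^G`-modules to `𝓜'_A`. -/
def extensionFunctor' : ModuleCat.{max v u₃} μ.invariants ⥤
    (generatedByInvariants.{max v u₃} μ).FullSubcategory :=
  (generatedByInvariants μ).lift (extensionFunctor.{v} μ) (generatedByInvariants_extend μ)

end Extension

/-- `M` is a (finitely generated) projective `B`-module of constant rank `r`. -/
def IsProjectiveOfRank (B : Type v) (M : Type w) [CommRing B] [AddCommGroup M] [Module B M]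
    (r : ℕ) : Prop :=
  Module.Finite B M ∧ Module.Projective B M ∧
    ∀ p : PrimeSpectrum B, Module.rankAtStalk (R := B) M p = r

end

end GroupSchemeAction

open GroupSchemeAction

universe v u₁ u₂ u₃

namespace GroupSchemeAction

universe w

/-! The index of `G_x` is the dimension of the image of the comorphism `k[X] → k[G]` of the orbit
morphism (`Action.finrank_range_orbitMap`). That image and `k[G]^{G_x}` are right coideal
subalgebras of `k[G]`, and their functions vanishing at the unit generate the same ideal, that of
`G_x`. Since `k[G]` is free over any right coideal subalgebra, of rank the dimension of the fibre at
the unit (`finrank_eq_finrank_mul_finrank_quotient`), the two have equal dimension. So regularity of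
all points says that all orbit images have one dimension `d`.

Constant rank gives local freeness. Choose `d` functions `a i` whose restrictions to the orbit of
`x` form a basis. By Cramer's rule, with a suitable determinant `s` as denominator, the coaction of
every `b` is a combination of the coactions of the `a i`. A norm argument makes `s` invariant, and
comparing two ways of iterating the coaction shows that the coefficients are invariant as well. An
invariant partition of unity then gives (`Action.exists_dualBasis`) a finite dual basis of `A` over
`A^G` and a retraction `A → A^G`, both obtained by contracting the coaction with linear maps `R →
A`.

Such contractions act on every `(A, G)`-module and commute with all morphisms. On modules generated
by invariants the dual basis formula therefore persists, and the closure properties, the equivalence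
and the statement on ranks follow from it. -/

open TensorProduct in
/-- Elements of `M ⊗ V` over a field are separated by the linear forms on the second factor. -/
theorem eq_zero_of_forall_lTensor_dual {k M V : Type*} [Field k] [AddCommGroup M] [Module k M]
    [AddCommGroup V] [Module k V] (z : M ⊗[k] V)
    (h : ∀ f : Module.Dual k V, TensorProduct.rid k M (f.lTensor M z) = 0) : z = 0 := by
  classical
  let b := Module.Basis.ofVectorSpace k V
  apply (TensorProduct.equivFinsuppOfBasisRight b).injective
  rw [map_zero]
  ext i
  rw [TensorProduct.equivFinsuppOfBasisRight_apply]
  exact h (b.coord i)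

/-! ### Relations over right coideal subalgebras. -/

section Coideal

variable {k : Type u₁} {R : Type u₂} [Field k] [CommRing R] [HopfAlgebra k R]

open Coalgebra Bialgebra HopfAlgebra Algebra.TensorProduct WithConv

/-- The right translation `f ↦ (h ↦ f (h g))` of functions on `G` by `g ∈ G(k)`. -/
noncomputable def rightTranslation (g : R →ₐ[k] k) : R →ₐ[k] R :=
  (toConv (AlgHom.id k R) * toConv ((Algebra.ofId k R).comp g)).ofConv

theorem comp_rightTranslation (g h : R →ₐ[k] k) :
    h.comp (rightTranslation g) = (toConv h * toConv g).ofConv := by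
  rw [rightTranslation, AlgHom.comp_convMul_distrib]
  congr 3
  ext
  simp [Algebra.ofId_apply]

theorem rightTranslation_comp (g h : R →ₐ[k] k) :
    (rightTranslation g).comp (rightTranslation h) =
      rightTranslation (toConv g * toConv h).ofConv := by
  apply toConv_injective
  conv_lhs => rw [rightTranslation.eq_1 h, AlgHom.comp_convMul_distrib]
  rw [rightTranslation, rightTranslation, AlgHom.comp_convMul_distrib]
  simp only [WithConv.toConv_ofConv, AlgHom.comp_id]
  rw [mul_assoc]
  congr 3
  ext
  simp [Algebra.ofId_apply]

theorem rightTranslation_counit : rightTranslation (counitAlgHom k R) = AlgHom.id k R := by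
  rw [rightTranslation, ← AlgHom.convOne_def, mul_one]

/-- As `(x, y) ↦ (x y, y)` is an automorphism of `G × G`, the elements `Δ(a) (1 ⊗ s)` span
`k[G] ⊗ k[G]`. -/
theorem exists_sum_comul_mul_eq (w : R ⊗[k] R) :
    w ∈ Submodule.span k {z | ∃ a s : R, z = comul (R := k) a * (1 : R) ⊗ₜ[k] s} := by
  let inl : R →ₐ[k] R ⊗[k] R := includeLeft
  let inr : R →ₐ[k] R ⊗[k] R := includeRight
  let σ : R ⊗[k] R →ₐ[k] R ⊗[k] R := lift (comulAlgHom k R) inr fun _ _ => Commute.all _ _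
  -- `σ` is the comorphism of `(x, y) ↦ (x y, y)` and `τ` that of `(x, y) ↦ x y⁻¹`, so `lift τ inr`
  -- will be a right inverse of `σ`.
  let τ : R →ₐ[k] R ⊗[k] R := (toConv inl * toConv (inr.comp (antipodeAlgHom k R))).ofConv
  have hΔ : comulAlgHom k R = (toConv inl * toConv inr).ofConv := by
    rw [AlgHom.convMul_def]
    ext x
    have : (lmul' k).comp (Algebra.TensorProduct.map inl inr) = AlgHom.id k (R ⊗[k] R) := by
      ext <;> simp [inl, inr]
    simpa using (DFunLike.congr_fun this (comul (R := k) x)).symm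
  have hστ : σ.comp τ = inl := by
    have h1 : σ.comp inl = comulAlgHom k R := by ext; simp [σ, inl]
    have h2 : σ.comp inr = inr := by ext; simp [σ, inr]
    rw [AlgHom.comp_convMul_distrib]
    dsimp only
    rw [h1, ← AlgHom.comp_assoc, h2, hΔ, toConv_ofConv, mul_assoc]
    have : toConv inr * toConv (inr.comp (antipodeAlgHom k R)) = 1 := mul_inv_cancel (toConv inr)
    rw [this, mul_one]
  have hσ : ∀ z, σ z ∈ Submodule.span k {z | ∃ a s : R, z = comul (R := k) a * (1 : R) ⊗ₜ[k] s} := by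
    intro z
    induction z using TensorProduct.induction_on with
    | zero => simp
    | add x y hx hy => rw [map_add]; exact add_mem hx hy
    | tmul a s => exact Submodule.subset_span ⟨a, s, rfl⟩
  have : w = σ (lift τ inr (fun _ _ => Commute.all _ _) w) := by
    have : σ.comp (lift τ inr (fun _ _ => Commute.all _ _)) = AlgHom.id k _ := by
      ext x
      · simpa [inl] using DFunLike.congr_fun hστ x
      · simp [σ, inr]
    exact (DFunLike.congr_fun this w).symm
  rw [this]
  exact hσ _

variable {C : Type*} [CommRing C] [Algebra k C] {D : Type*} [CommRing D] [Algebra k D]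

/-- If the coefficients of all `C`-linear relations between generators `r i` of `k[G]` vanish in
`D`, then their coactions vanish in `D ⊗ k[G]`. -/
theorem map_coact_eq_zero_of_relation {ι : C →ₐ[k] R} {δ : C →ₐ[k] C ⊗[k] R}
    (hδ : ∀ c, Algebra.TensorProduct.map ι (AlgHom.id k R) (δ c) = comul (R := k) (ι c))
    (π : C →ₐ[k] D) {n : ℕ} (r : Fin n → R) (hr : ∀ a, ∃ b : Fin n → C, a = ∑ i, ι (b i) * r i)
    (hπ : ∀ b : Fin n → C, ∑ i, ι (b i) * r i = 0 → ∀ i, π (b i) = 0)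
    (b : Fin n → C) (hb : ∑ i, ι (b i) * r i = 0) (i : Fin n) :
    Algebra.TensorProduct.map π (AlgHom.id k R) (δ (b i)) = 0 := by
  set j : C ⊗[k] R →ₐ[k] R ⊗[k] R := Algebra.TensorProduct.map ι (AlgHom.id k R) with hj
  set p : C ⊗[k] R →ₐ[k] D ⊗[k] R := Algebra.TensorProduct.map π (AlgHom.id k R) with hp
  -- Linear forms on the second factor reduce relations with coefficients in `C ⊗ R` to relations
  -- over `C`, where `hπ` applies.
  have hrel : ∀ z : Fin n → C ⊗[k] R, ∑ i, j (z i) * (r i ⊗ₜ[k] (1 : R)) = 0 →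
      ∀ i, p (z i) = 0 := by
    intro z hz i
    apply eq_zero_of_forall_lTensor_dual
    intro f
    have h1 : ∀ w : C ⊗[k] R, TensorProduct.rid k _ (f.lTensor _ (p w)) =
        π (TensorProduct.rid k _ (f.lTensor _ w)) := by
      intro w
      induction w using TensorProduct.induction_on with
      | zero => simp
      | add x y hx hy => simp only [map_add, hx, hy]
      | tmul a s => simp [p]
    have h2 : ∀ (w : C ⊗[k] R) (s : R), TensorProduct.rid k _ (f.lTensor _
        (j w * (s ⊗ₜ[k] (1 : R)))) = ι (TensorProduct.rid k _ (f.lTensor _ w)) * s := by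
      intro w s
      induction w using TensorProduct.induction_on with
      | zero => simp
      | add x y hx hy => simp only [map_add, hx, hy, add_mul]
      | tmul a s => simp [j]
    rw [h1]
    refine hπ (fun i => TensorProduct.rid k _ (f.lTensor _ (z i))) ?_ i
    have h3 := congrArg (fun t => TensorProduct.rid k _ (f.lTensor _ t)) hz
    simpa only [map_sum, h2, map_zero] using h3
  have hgen1 : ∀ a : R, ∃ z : Fin n → C ⊗[k] R,
      comul (R := k) a = ∑ i, j (z i) * (r i ⊗ₜ[k] (1 : R)) := by
    intro a
    induction comul (R := k) a using TensorProduct.induction_on with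
    | zero => exact ⟨0, by simp⟩
    | add x y hx hy =>
      obtain ⟨z, rfl⟩ := hx
      obtain ⟨z', rfl⟩ := hy
      exact ⟨z + z', by simp [add_mul, Finset.sum_add_distrib]⟩
    | tmul a s =>
      obtain ⟨c, rfl⟩ := hr a
      exact ⟨fun i => c i ⊗ₜ s, by simp [j, TensorProduct.sum_tmul]⟩
  -- The coactions of the `r i` also generate `R ⊗ R` over `C ⊗ R`: this is where the coideal
  -- property of `C` meets the spanning by the `Δ(a) (1 ⊗ s)`.
  have hgen2 : ∀ w : R ⊗[k] R, ∃ z : Fin n → C ⊗[k] R,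
      w = ∑ i, j (z i) * comul (R := k) (r i) := by
    intro w
    induction exists_sum_comul_mul_eq w using Submodule.span_induction with
    | zero => exact ⟨0, by simp⟩
    | add x y _ _ hx hy =>
      obtain ⟨z, rfl⟩ := hx
      obtain ⟨z', rfl⟩ := hy
      exact ⟨z + z', by simp [add_mul, Finset.sum_add_distrib]⟩
    | smul c x _ hx =>
      obtain ⟨z, rfl⟩ := hx
      exact ⟨c • z, by simp [Finset.smul_sum]⟩
    | mem x hx =>
      obtain ⟨a, s, rfl⟩ := hx
      obtain ⟨c, rfl⟩ := hr a
      refine ⟨fun i => δ (c i) * (1 : C) ⊗ₜ[k] s, ?_⟩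
      simp only [map_sum, comul_mul, map_mul, hδ, Finset.sum_mul]
      refine Finset.sum_congr rfl fun i _ => ?_
      simp [j, mul_right_comm]
  choose c hc using fun i => hgen1 (r i)
  choose c' hc' using fun i => hgen2 (r i ⊗ₜ[k] (1 : R))
  -- The transition matrices `c` and `c'` between the two generating families need not be inverse
  -- over `C ⊗ R`, but each row of `c' c - 1` is a relation between the `r l ⊗ 1`, hence dies under
  -- `p`. The matrices are square, so `c` becomes invertible in `D ⊗ R`.
  have hcc : (Matrix.of c').map p * (Matrix.of c).map p = 1 := by
    rw [← Matrix.map_mul]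
    ext i l
    have h1 : ∑ l, j ((Matrix.of c' * Matrix.of c - 1 : Matrix _ _ _) i l) *
        (r l ⊗ₜ[k] (1 : R)) = 0 := by
      simp only [Matrix.sub_apply, map_sub, sub_mul, Finset.sum_sub_distrib, Matrix.one_apply,
        Matrix.mul_apply, Matrix.of_apply, map_sum, map_mul, Finset.sum_mul]
      rw [Finset.sum_comm]
      simp only [mul_assoc, ← Finset.mul_sum, ← hc, ← hc', apply_ite j, map_one, map_zero, ite_mul,
        one_mul, zero_mul, Finset.sum_ite_eq, Finset.mem_univ, if_true, sub_self]
    have h2 := hrel _ h1 l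
    rw [Matrix.sub_apply, map_sub, sub_eq_zero] at h2
    rw [Matrix.map_apply, h2, Matrix.one_apply, Matrix.one_apply]
    split_ifs <;> simp
  have hcc' := mul_eq_one_comm.1 hcc
  have h1 : ∑ l, j (∑ i, δ (b i) * c i l) * (r l ⊗ₜ[k] (1 : R)) = 0 := by
    simp only [map_sum, map_mul, Finset.sum_mul]
    rw [Finset.sum_comm]
    simp only [mul_assoc, ← Finset.mul_sum, ← hc, hδ]
    simpa only [map_sum, map_zero, comul_mul] using congrArg (comul (R := k)) hb
  have h2 : Matrix.vecMul (fun i => p (δ (b i))) ((Matrix.of c).map p) = 0 := by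
    ext l
    have := hrel _ h1 l
    simpa [Matrix.vecMul, dotProduct] using this
  have h3 := congrArg (fun v => Matrix.vecMul v ((Matrix.of c').map p)) h2
  simp only [Matrix.vecMul_vecMul, hcc', Matrix.vecMul_one, Matrix.zero_vecMul] at h3
  exact congrFun h3 i

/-- Generators of `k[G]` over a right coideal subalgebra which are minimal at the unit element
of `G` are free generators. -/
theorem eq_zero_of_relation {ι : C →ₐ[k] R} (hι : Function.Injective ι) {δ : C →ₐ[k] C ⊗[k] R}
    (hδ : ∀ c, Algebra.TensorProduct.map ι (AlgHom.id k R) (δ c) = comul (R := k) (ι c))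
    {n : ℕ} (r : Fin n → R) (hr : ∀ a, ∃ b : Fin n → C, a = ∑ i, ι (b i) * r i)
    (hε : ∀ b : Fin n → C, ∑ i, ι (b i) * r i = 0 → ∀ i, counit (R := k) (ι (b i)) = 0)
    (b : Fin n → C) (hb : ∑ i, ι (b i) * r i = 0) (i : Fin n) : b i = 0 := by
  -- Taking `D = C ⧸ J` for the ideal of all coefficients of relations makes the hypothesis on `π`
  -- automatic. As the counit kills `J`, it can then be applied to the first factor, and `(ε ⊗ id) Δ
  -- = id` recovers `b i`.
  let J : Ideal C := Ideal.span {c | ∃ b : Fin n → C, ∑ i, ι (b i) * r i = 0 ∧ ∃ i, b i = c}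
  have hJ : ∀ b : Fin n → C, ∑ i, ι (b i) * r i = 0 → ∀ i, b i ∈ J := fun b hb i =>
    Ideal.subset_span ⟨b, hb, i, rfl⟩
  have hJε : ∀ b ∈ J, counit (R := k) (ι b) = 0 := by
    intro b hb
    have : J ≤ RingHom.ker ((counitAlgHom k R).comp ι) := by
      refine Ideal.span_le.2 ?_
      rintro _ ⟨b, hb, i, rfl⟩
      exact hε b hb i
    exact this hb
  have h0 := map_coact_eq_zero_of_relation hδ (Ideal.Quotient.mkₐ k J) r hr
    (fun b hb i => Ideal.Quotient.eq_zero_iff_mem.2 (hJ b hb i)) b hb i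
  let e : (C ⧸ J) →ₐ[k] k := Ideal.Quotient.liftₐ J ((counitAlgHom k R).comp ι) hJε
  have h1 := congrArg (Algebra.TensorProduct.map e (AlgHom.id k R)) h0
  rw [map_zero, ← AlgHom.comp_apply, ← Algebra.TensorProduct.map_comp] at h1
  have h2 : e.comp (Ideal.Quotient.mkₐ k J) = (counitAlgHom k R).comp ι := by ext; rfl
  have h3 : ∀ c, Algebra.TensorProduct.map ((counitAlgHom k R).comp ι) (AlgHom.id k R) (δ c) =
      1 ⊗ₜ ι c := by
    intro c
    rw [← rTensor_counit_comul, ← hδ]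
    conv_lhs => rw [← AlgHom.comp_id (AlgHom.id k R), Algebra.TensorProduct.map_comp]
    rfl
  rw [h2, AlgHom.comp_id, h3] at h1
  apply hι
  rw [map_zero]
  simpa using congrArg (TensorProduct.lid k R) h1

end Coideal

/-! ### Rational points and generators over semilocal rings. -/

/-- The weak Nullstellensatz: a maximal ideal of a finitely generated algebra over an algebraically
closed field is the kernel of a rational point. -/
theorem exists_ker_eq_of_isMaximal {k A : Type*} [Field k] [IsAlgClosed k] [CommRing A]
    [Algebra k A] [Algebra.FiniteType k A] (m : Ideal A) [hm : m.IsMaximal] :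
    ∃ x : A →ₐ[k] k, RingHom.ker x = m := by
  let := Ideal.Quotient.field m
  have := finite_of_finite_type_of_isJacobsonRing k (A ⧸ m)
  have hb := IsAlgClosed.algebraMap_bijective_of_isIntegral (k := k) (K := A ⧸ m)
  let e : k ≃ₐ[k] A ⧸ m := AlgEquiv.ofBijective (Algebra.ofId k _) hb
  refine ⟨e.symm.toAlgHom.comp (Ideal.Quotient.mkₐ k m), ?_⟩
  ext a
  simp [RingHom.mem_ker, Ideal.Quotient.eq_zero_iff_mem]

/-- A module over a semilocal ring whose fibres are generated by `n` elements is generated by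
`n` elements. -/
theorem exists_span_range_eq_top_of_forall_isMaximal {C R : Type*} [CommRing C]
    [Finite (MaximalSpectrum C)] [AddCommGroup R] [Module C R] [Module.Finite C R] {n : ℕ}
    (h : ∀ M : Ideal C, M.IsMaximal → ∃ s : Fin n → R,
      Submodule.span C (Set.range s) ⊔ M • (⊤ : Submodule C R) = ⊤) :
    ∃ r : Fin n → R, Submodule.span C (Set.range r) = ⊤ := by
  classical
  have := Fintype.ofFinite (MaximalSpectrum C)
  choose s hs using fun M : MaximalSpectrum C => h M.1 M.2
  have hcop : Pairwise (Function.onFun IsCoprime fun M : MaximalSpectrum C => M.1) := by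
    intro M N hMN
    exact Ideal.isCoprime_iff_sup_eq.2 (M.2.coprime_of_ne N.2 fun h => hMN (MaximalSpectrum.ext h))
  choose e he using fun M : MaximalSpectrum C =>
    Ideal.exists_forall_sub_mem_ideal (I := fun M : MaximalSpectrum C => M.1) hcop
      (fun N => if N = M then 1 else 0)
  let r : Fin n → R := fun i => ∑ M, e M • s M i
  refine ⟨r, ?_⟩
  have hr : ∀ M i, s M i - r i ∈ (M.1 • ⊤ : Submodule C R) := by
    intro M i
    have h1 : s M i - r i = ∑ N, ((if M = N then 1 else 0) - e N) • s N i := by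
      simp [r, sub_smul, Finset.sum_sub_distrib, ite_smul]
    rw [h1]
    refine Submodule.sum_mem _ fun N _ => Submodule.smul_mem_smul ?_ Submodule.mem_top
    rw [← neg_sub]
    exact M.1.neg_mem (he N M)
  set N := Submodule.span C (Set.range r) with hN
  have hN' : ∀ M : MaximalSpectrum C, N ⊔ M.1 • (⊤ : Submodule C R) = ⊤ := by
    intro M
    refine top_le_iff.1 ((hs M).ge.trans (sup_le
      (Submodule.span_le.2 (Set.range_subset_iff.2 fun i => ?_)) le_sup_right))
    have h1 := add_mem (Submodule.mem_sup_left (T := M.1 • (⊤ : Submodule C R))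
      (Submodule.subset_span (Set.mem_range_self i))) (Submodule.mem_sup_right (S := N) (hr M i))
    rwa [add_sub_cancel] at h1
  -- Nakayama's lemma at each maximal ideal: `R ⧸ N` is killed by an element congruent to one modulo
  -- `M`.
  have hann : Module.annihilator C (R ⧸ N) = ⊤ := by
    by_contra hne
    obtain ⟨M, hM, hle⟩ := Ideal.exists_le_maximal _ hne
    obtain ⟨c, hc, hc'⟩ := Submodule.exists_sub_one_mem_and_smul_eq_zero_of_fg_of_le_smul M
      (⊤ : Submodule C (R ⧸ N)) Module.Finite.fg_top (by
        have h1 := congrArg (Submodule.map N.mkQ) (hN' ⟨M, hM⟩)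
        rw [Submodule.map_sup, Submodule.mkQ_map_self, bot_sup_eq, Submodule.map_smul'',
          Submodule.map_top, Submodule.range_mkQ] at h1
        exact h1.ge)
    have h1 : c ∈ M := hle (Module.mem_annihilator.2 fun q => hc' q Submodule.mem_top)
    exact hM.ne_top ((Ideal.eq_top_iff_one M).2 (by simpa using M.sub_mem h1 hc))
  have := Module.annihilator_eq_top_iff.1 hann
  exact Submodule.Quotient.subsingleton_iff.1 this

/-! ### Freeness of `k[G]` over right coideal subalgebras. -/

section Coideal

variable {k : Type u₁} {R : Type u₂} [Field k] [CommRing R] [HopfAlgebra k R]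

open Coalgebra Bialgebra HopfAlgebra Algebra.TensorProduct WithConv

theorem rightTranslation_eq {C : Type*} [CommRing C] [Algebra k C] {ι : C →ₐ[k] R}
    {δ : C →ₐ[k] C ⊗[k] R}
    (hδ : ∀ c, Algebra.TensorProduct.map ι (AlgHom.id k R) (δ c) = comul (R := k) (ι c))
    (g : R →ₐ[k] k) (c : C) : rightTranslation g (ι c) =
      ι (TensorProduct.rid k C (g.toLinearMap.lTensor C (δ c))) := by
  rw [rightTranslation, AlgHom.convMul_apply, ← hδ]
  induction δ c using TensorProduct.induction_on with
  | zero => simp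
  | add x y hx hy => simp only [map_add, hx, hy]
  | tmul a s => simp [Algebra.smul_def, mul_comm, Algebra.ofId_apply]

/-- By flatness over `k`, `C ⊗ R` embeds into `R ⊗ R`, so the comultiplication can be corestricted
to it. -/
theorem exists_coact_of_forall_comul_mem_range {C : Subalgebra k R}
    (hC : ∀ c ∈ C, comul (R := k) c ∈ LinearMap.range (C.val.toLinearMap.rTensor R)) :
    ∃ δ : C →ₐ[k] C ⊗[k] R,
      ∀ c, Algebra.TensorProduct.map C.val (AlgHom.id k R) (δ c) = comul (R := k) (c : R) := by
  set j : C ⊗[k] R →ₐ[k] R ⊗[k] R := Algebra.TensorProduct.map C.val (AlgHom.id k R) with hj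
  have hinj : Function.Injective j :=
    Module.Flat.rTensor_preserves_injective_linearMap (M := R) C.val.toLinearMap
      Subtype.val_injective
  refine ⟨(AlgEquiv.ofInjective j hinj).symm.toAlgHom.comp
    (((comulAlgHom k R).comp C.val).codRestrict j.range fun c => hC c c.2), fun c => ?_⟩
  exact congrArg Subtype.val ((AlgEquiv.ofInjective j hinj).apply_symm_apply
    ⟨comul (R := k) (c : R), hC c c.2⟩)

variable [IsAlgClosed k] [Module.Finite k R]

/-- The Hopf algebra `k[G]` of a finite group scheme is free over each right coideal subalgebra
`C`, of rank the dimension of the fibre at the unit element. -/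
theorem finrank_eq_finrank_mul_finrank_quotient {C : Subalgebra k R} {δ : C →ₐ[k] C ⊗[k] R}
    (hδ : ∀ c, Algebra.TensorProduct.map C.val (AlgHom.id k R) (δ c) = comul (R := k) (c : R))
    (I : Ideal R) (hI : I = Ideal.span {a | a ∈ C ∧ counit (R := k) a = 0}) :
    Module.finrank k R = Module.finrank k C * Module.finrank k (R ⧸ I) := by
  have : IsArtinianRing C := IsArtinianRing.of_finite k C
  have : Module.Finite C R := Module.Finite.of_restrictScalars_finite k C R
  have hmk : ∀ c : C, Ideal.Quotient.mk I (c : R) =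
      algebraMap k (R ⧸ I) (counit (R := k) (c : R)) := by
    intro c
    rw [← Ideal.Quotient.mk_algebraMap, Ideal.Quotient.mk_eq_mk_iff_sub_mem, hI]
    exact Ideal.subset_span ⟨sub_mem c.2 (algebraMap_mem C _), by simp⟩
  let b := Module.finBasis k (R ⧸ I)
  choose s hs using fun i => Ideal.Quotient.mk_surjective (b i)
  obtain ⟨r, hr⟩ := exists_span_range_eq_top_of_forall_isMaximal (C := C) (R := R)
    (n := Module.finrank k (R ⧸ I)) (by
      intro M hM
      -- Homogeneity: `M` lies below a rational point `g` of `G`, and right translation by `g⁻¹`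
      -- carries generators of the fibre at the unit to generators of the fibre at `M`.
      obtain ⟨Q, hQ, hQM⟩ := Ideal.exists_ideal_over_maximal_of_isIntegral (S := R) M (by
        rw [(RingHom.injective_iff_ker_eq_bot _).1 (FaithfulSMul.algebraMap_injective C R)]
        exact bot_le)
      obtain ⟨g, hg⟩ := exists_ker_eq_of_isMaximal (k := k) Q
      have hgM : ∀ c : C, g c = 0 ↔ c ∈ M := by
        intro c
        rw [← hQM, Ideal.mem_comap, ← hg]
        rfl
      let h : R →ₐ[k] k := ((toConv g)⁻¹).ofConv
      have hgh : (rightTranslation g).comp (rightTranslation h) = AlgHom.id k R := by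
        rw [rightTranslation_comp, ← rightTranslation_counit]
        congr 1
        change (toConv g * (toConv g)⁻¹).ofConv = _
        rw [mul_inv_cancel]
        rfl
      have hhg : (rightTranslation h).comp (rightTranslation g) = AlgHom.id k R := by
        rw [rightTranslation_comp, ← rightTranslation_counit]
        congr 1
        change ((toConv g)⁻¹ * (toConv g)).ofConv = _
        rw [inv_mul_cancel]
        rfl
      have hIM : ∀ a ∈ I, rightTranslation h a ∈ (M • ⊤ : Submodule C R) := by
        have hle : I ≤ (M.map (algebraMap C R)).comap (rightTranslation h) := by
          rw [hI, Ideal.span_le]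
          rintro a ⟨ha, ha0⟩
          have h1 := rightTranslation_eq (ι := C.val) hδ h ⟨a, ha⟩
          simp only [Subalgebra.coe_val] at h1
          refine Ideal.mem_comap.2 ?_
          rw [h1]
          refine Ideal.mem_map_of_mem _ ((hgM _).1 ?_)
          rw [← h1, ← AlgHom.comp_apply, comp_rightTranslation]
          change (toConv g * (toConv g)⁻¹).ofConv a = 0
          rw [mul_inv_cancel]
          simpa using ha0
        intro a ha
        have h2 := hle ha
        rw [Ideal.mem_comap] at h2
        rw [Ideal.smul_top_eq_map]
        exact h2
      refine ⟨fun i => rightTranslation h (s i), ?_⟩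
      rw [eq_top_iff]
      intro a _
      have h1 : Ideal.Quotient.mk I (rightTranslation g a) = Ideal.Quotient.mk I
          (∑ i, b.repr (Ideal.Quotient.mk I (rightTranslation g a)) i • s i) := by
        conv_lhs => rw [← b.sum_repr (Ideal.Quotient.mk I (rightTranslation g a))]
        rw [map_sum]
        refine Finset.sum_congr rfl fun i _ => ?_
        rw [Algebra.smul_def, Algebra.smul_def, map_mul, hs, Ideal.Quotient.mk_algebraMap]
      rw [Ideal.Quotient.mk_eq_mk_iff_sub_mem] at h1
      have h2 := hIM _ h1
      rw [map_sub, ← AlgHom.comp_apply, hhg, AlgHom.id_apply, map_sum] at h2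
      rw [← sub_add_cancel a]
      refine add_mem (Submodule.mem_sup_right h2) (Submodule.mem_sup_left ?_)
      refine Submodule.sum_mem _ fun i _ => ?_
      rw [map_smul, ← algebraMap_smul C]
      exact Submodule.smul_mem _ _ (Submodule.subset_span ⟨i, rfl⟩))
  have hr' : ∀ a, ∃ c : Fin (Module.finrank k (R ⧸ I)) → C, a = ∑ i, C.val (c i) * r i := by
    intro a
    have ha : a ∈ Submodule.span C (Set.range r) := hr ▸ Submodule.mem_top
    obtain ⟨c, rfl⟩ := (Submodule.mem_span_range_iff_exists_fun C).1 ha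
    exact ⟨c, rfl⟩
  -- Modulo `I`, elements of `C` act through the counit. The `r i` thus span `R ⧸ I` over `k`, and
  -- their number is its dimension. Hence relations over `C` have coefficients vanishing at the
  -- unit, as `eq_zero_of_relation` requires.
  have hli : LinearIndependent k fun i => Ideal.Quotient.mk I (r i) := by
    refine linearIndependent_of_top_le_span_of_card_eq_finrank ?_ (by simp)
    intro q _
    obtain ⟨a, rfl⟩ := Ideal.Quotient.mk_surjective q
    obtain ⟨c, rfl⟩ := hr' a
    rw [map_sum]
    refine Submodule.sum_mem _ fun i _ => ?_
    rw [map_mul, Subalgebra.coe_val, hmk, ← Algebra.smul_def]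
    exact Submodule.smul_mem _ _ (Submodule.subset_span ⟨i, rfl⟩)
  have h0 := eq_zero_of_relation (ι := C.val) Subtype.val_injective hδ r hr' (by
    intro c hc
    have h1 := congrArg (Ideal.Quotient.mk I) hc
    simp only [map_sum, map_mul, map_zero, Subalgebra.coe_val, hmk, ← Algebra.smul_def] at h1
    exact Fintype.linearIndependent_iff.1 hli _ h1)
  let Φ : (Fin (Module.finrank k (R ⧸ I)) → C) →ₗ[k] R :=
    ∑ i, (LinearMap.mulRight k (r i) ∘ₗ C.val.toLinearMap) ∘ₗ LinearMap.proj i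
  have hΦ : ∀ c, Φ c = ∑ i, C.val (c i) * r i := fun c => by simp [Φ]
  have hbij : Function.Bijective Φ := by
    refine ⟨(injective_iff_map_eq_zero _).2 fun c hc => funext fun i => h0 c ?_ i, fun a => ?_⟩
    · rw [← hΦ, hc]
    · obtain ⟨c, rfl⟩ := hr' a
      exact ⟨c, hΦ c⟩
  rw [← (LinearEquiv.ofBijective Φ hbij).finrank_eq, Module.finrank_pi_fintype]
  simp [mul_comm]

end Coideal

/-! ### Orbit morphisms and the index of the stabilizer. -/

section Orbits

open Coalgebra Bialgebra HopfAlgebra Algebra.TensorProduct WithConv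

variable {k : Type u₁} {R : Type u₂} {A : Type u₃} [Field k] [CommRing R] [HopfAlgebra k R]
  [CommRing A] [Algebra k A]

theorem mem_leftInvariants {I : Ideal R} {f : R} : f ∈ leftInvariants (k := k) I ↔
    Algebra.TensorProduct.map (Ideal.Quotient.mkₐ k I) (AlgHom.id k R) (comul (R := k) f) =
      1 ⊗ₜ f := Iff.rfl

/-- The invariants are the kernel of a linear map, and tensoring with `R` preserves this kernel by
flatness. Membership of the comultiplication in the tensored kernel is then coassociativity: left
and right translations commute. -/
theorem comul_mem_range_of_mem_leftInvariants (I : Ideal R) :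
    ∀ f ∈ leftInvariants (k := k) I, comul (R := k) f ∈
      LinearMap.range ((leftInvariants (k := k) I).val.toLinearMap.rTensor R) := by
  intro f hf
  let P : R →ₐ[k] (R ⧸ I) ⊗[k] R :=
    (Algebra.TensorProduct.map (Ideal.Quotient.mkₐ k I) (AlgHom.id k R)).comp (comulAlgHom k R)
  let Q : R →ₐ[k] (R ⧸ I) ⊗[k] R := includeRight
  have hex : Function.Exact (leftInvariants (k := k) I).val.toLinearMap
      (P.toLinearMap - Q.toLinearMap) := by
    intro y
    rw [LinearMap.sub_apply, sub_eq_zero]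
    constructor
    · intro h
      exact ⟨⟨y, h⟩, rfl⟩
    · rintro ⟨⟨y, h⟩, rfl⟩
      exact h
  refine (Module.Flat.rTensor_exact R hex _).1 ?_
  rw [LinearMap.rTensor_sub]
  refine Eq.trans (b := P.toLinearMap.rTensor R (comul (R := k) f) -
    Q.toLinearMap.rTensor R (comul (R := k) f)) rfl (sub_eq_zero.2 ?_)
  apply (TensorProduct.assoc k (R ⧸ I) R R).injective
  have hP : ∀ w : R ⊗[k] R, TensorProduct.assoc k (R ⧸ I) R R
      ((Algebra.TensorProduct.map (Ideal.Quotient.mkₐ k I) (AlgHom.id k R)).toLinearMap.rTensor R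
        ((comul (R := k)).rTensor R w)) =
      (Ideal.Quotient.mkₐ k I).toLinearMap.rTensor _ (TensorProduct.assoc k R R R
        ((comul (R := k)).rTensor R w)) := by
    intro w
    generalize (comul (R := k)).rTensor R w = z
    induction z using TensorProduct.induction_on with
    | zero => simp
    | add x y hx hy => simp only [map_add, hx, hy]
    | tmul a s =>
      induction a using TensorProduct.induction_on with
      | zero => simp
      | add x y hx hy => simp only [map_add, TensorProduct.add_tmul, hx, hy]
      | tmul a b => simp
  have h1 : P.toLinearMap.rTensor R (comul (R := k) f) =
      (Algebra.TensorProduct.map (Ideal.Quotient.mkₐ k I) (AlgHom.id k R)).toLinearMap.rTensor R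
        ((comul (R := k)).rTensor R (comul (R := k) f)) := by
    rw [← LinearMap.rTensor_comp_apply]
    rfl
  have hQ : ∀ w : R ⊗[k] R, TensorProduct.assoc k (R ⧸ I) R R (Q.toLinearMap.rTensor R w) =
      1 ⊗ₜ w := by
    intro w
    induction w using TensorProduct.induction_on with
    | zero => simp
    | add x y hx hy => simp only [map_add, hx, hy, TensorProduct.tmul_add]
    | tmul a s => simp [Q]
  rw [h1, hP, hQ, Coalgebra.coassoc_apply, ← LinearMap.comp_apply, LinearMap.rTensor_comp_lTensor,
    ← LinearMap.lTensor_comp_rTensor, LinearMap.comp_apply]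
  have h2 : (Ideal.Quotient.mkₐ k I).toLinearMap.rTensor R (comul (R := k) f) = 1 ⊗ₜ f := hf
  rw [h2, LinearMap.lTensor_tmul]

/-- Put `g = 1` in `f (h g) = f g`: the restriction of `f` to `H` is the constant `f 1`. -/
theorem mem_of_mem_leftInvariants {I : Ideal R} {f : R} (hf : f ∈ leftInvariants (k := k) I)
    (h0 : counit (R := k) f = 0) : f ∈ I := by
  have h1 := congrArg (fun z => TensorProduct.rid k _ ((counit (R := k)).lTensor _ z))
    (mem_leftInvariants.1 hf)
  have h2 : ∀ w : R ⊗[k] R, TensorProduct.rid k _ ((counit (R := k)).lTensor _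
      (Algebra.TensorProduct.map (Ideal.Quotient.mkₐ k I) (AlgHom.id k R) w)) =
      Ideal.Quotient.mkₐ k I (TensorProduct.rid k _ ((counit (R := k)).lTensor _ w)) := by
    intro w
    induction w using TensorProduct.induction_on with
    | zero => simp
    | add x y hx hy => simp only [map_add, hx, hy]
    | tmul a s => simp
  simp only [h2, lTensor_counit_comul, LinearMap.lTensor_tmul, h0, TensorProduct.tmul_zero,
    map_zero, TensorProduct.rid_tmul, one_smul] at h1
  exact Ideal.Quotient.eq_zero_iff_mem.1 h1

variable (μ : Action k R A)

theorem Action.coassoc (a : A) :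
    TensorProduct.assoc k A R R (Algebra.TensorProduct.map μ.coact (AlgHom.id k R) (μ.coact a)) =
      Algebra.TensorProduct.map (AlgHom.id k A) (comulAlgHom k R) (μ.coact a) :=
  LinearMap.congr_fun μ.isComodule.coassoc a

theorem Action.counit (a : A) :
    TensorProduct.rid k A ((Coalgebra.counit (R := k) (A := R)).lTensor A (μ.coact a)) = a :=
  LinearMap.congr_fun μ.isComodule.counit a

/-- The evaluation `A ⊗ R → R` at a rational point of `Spec A`. -/
noncomputable def evalLeft (R : Type u₂) [CommRing R] [Algebra k R] (x : A →ₐ[k] k) :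
    A ⊗[k] R →ₐ[k] R :=
  Algebra.TensorProduct.lift ((Algebra.ofId k R).comp x) (AlgHom.id k R)
    (fun _ _ => Commute.all _ _)

@[simp] theorem evalLeft_tmul (x : A →ₐ[k] k) (a : A) (r : R) :
    evalLeft R x (a ⊗ₜ[k] r) = x a • r := by
  simp [evalLeft, Algebra.ofId_apply, Algebra.smul_def]

theorem Action.orbitMap_apply (x : A →ₐ[k] k) (a : A) :
    μ.orbitMap x a = evalLeft R x (μ.coact a) := rfl

theorem Action.counit_orbitMap (x : A →ₐ[k] k) (a : A) :
    Coalgebra.counit (R := k) (μ.orbitMap x a) = x a := by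
  conv_rhs => rw [← μ.counit a]
  rw [μ.orbitMap_apply]
  induction μ.coact a using TensorProduct.induction_on with
  | zero => simp
  | add x y hx hy => simp only [map_add, hx, hy]
  | tmul a s => simp [mul_comm]

theorem Action.comul_orbitMap (x : A →ₐ[k] k) (a : A) :
    comul (R := k) (μ.orbitMap x a) =
      Algebra.TensorProduct.map (μ.orbitMap x) (AlgHom.id k R) (μ.coact a) := by
  have h1 : ∀ w : A ⊗[k] R, comul (R := k) (evalLeft R x w) =
      evalLeft (R ⊗[k] R) x (Algebra.TensorProduct.map (AlgHom.id k A) (comulAlgHom k R) w) := by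
    intro w
    induction w using TensorProduct.induction_on with
    | zero => simp
    | add x y hx hy => simp only [map_add, hx, hy]
    | tmul a s => simp [evalLeft, Algebra.ofId_apply]
  have h2 : ∀ w : (A ⊗[k] R) ⊗[k] R, evalLeft (R ⊗[k] R) x (TensorProduct.assoc k A R R w) =
      Algebra.TensorProduct.map (evalLeft R x) (AlgHom.id k R) w := by
    intro w
    induction w using TensorProduct.induction_on with
    | zero => simp
    | add x y hx hy => simp only [map_add, hx, hy]
    | tmul a s =>
      induction a using TensorProduct.induction_on with
      | zero => simp
      | add x y hx hy => simp only [map_add, TensorProduct.add_tmul, hx, hy]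
      | tmul a b => simp [evalLeft, Algebra.ofId_apply]
  rw [μ.orbitMap_apply, h1, ← μ.coassoc, h2, ← AlgHom.comp_apply, ← Algebra.TensorProduct.map_comp]
  rfl

/-- The left translation `f ↦ (h ↦ f (g h))` of functions on `G` by `g ∈ G(k)`. -/
noncomputable def leftTranslation (g : R →ₐ[k] k) : R →ₐ[k] R :=
  (toConv ((Algebra.ofId k R).comp g) * toConv (AlgHom.id k R)).ofConv

theorem leftTranslation_injective (g : R →ₐ[k] k) : Function.Injective (leftTranslation g) := by
  let h : R →ₐ[k] k := ((toConv g)⁻¹).ofConv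
  have : (leftTranslation h).comp (leftTranslation g) = AlgHom.id k R := by
    rw [leftTranslation.eq_1 g, AlgHom.comp_convMul_distrib]
    have h1 : (leftTranslation h).comp ((Algebra.ofId k R).comp g) = (Algebra.ofId k R).comp g := by
      ext
      simp [Algebra.ofId_apply]
    have h2 : toConv ((Algebra.ofId k R).comp g) * toConv ((Algebra.ofId k R).comp h) = 1 := by
      have := AlgHom.comp_convMul_distrib (Algebra.ofId k R) (toConv g) (toConv g)⁻¹
      rw [mul_inv_cancel] at this
      apply ofConv_injective
      refine this.symm.trans ?_
      ext
      simp [AlgHom.convOne_def, Algebra.ofId_apply]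
    dsimp only
    rw [h1, AlgHom.comp_id, leftTranslation, toConv_ofConv, ← mul_assoc, h2, one_mul]
  exact Function.LeftInverse.injective (g := leftTranslation h) fun x =>
    DFunLike.congr_fun this x

/-- The orbit morphism of `x g` is `h ↦ x (g h)`. Since left translations are injective,
independence of orbit functions at `x` carries over to all points of its orbit. -/
theorem Action.orbitMap_translate (x : A →ₐ[k] k) (g : R →ₐ[k] k) (a : A) :
    μ.orbitMap (μ.translate x g) a = leftTranslation g (μ.orbitMap x a) := by
  rw [leftTranslation, AlgHom.convMul_apply, μ.comul_orbitMap, μ.orbitMap_apply, ← μ.comp_orbitMap]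
  induction μ.coact a using TensorProduct.induction_on with
  | zero => simp
  | add x y hx hy => simp only [map_add, hx, hy]
  | tmul a s => simp [Algebra.ofId_apply, Algebra.smul_def]

theorem Action.orbitMap_mem_leftInvariants (x : A →ₐ[k] k) (a : A) :
    μ.orbitMap x a ∈ leftInvariants (k := k) (μ.stabilizerIdeal x) := by
  rw [mem_leftInvariants, μ.comul_orbitMap, μ.orbitMap_apply]
  have h1 : ∀ b : A, Ideal.Quotient.mk (μ.stabilizerIdeal x) (μ.orbitMap x b) =
      algebraMap k _ (x b) := by
    intro b
    rw [← Ideal.Quotient.mk_algebraMap, Ideal.Quotient.mk_eq_mk_iff_sub_mem]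
    have : μ.orbitMap x (b - algebraMap k A (x b)) ∈ μ.stabilizerIdeal x :=
      Ideal.mem_map_of_mem _ (by simp [RingHom.mem_ker])
    simpa using this
  induction μ.coact a using TensorProduct.induction_on with
  | zero => simp
  | add x y hx hy => simp only [map_add, hx, hy, TensorProduct.tmul_add]
  | tmul a s => simp [h1, Algebra.algebraMap_eq_smul_one, TensorProduct.smul_tmul]

/-- The orbit of `x` is the homogeneous space `G_x\G`: the image of the comorphism of the orbit
morphism has the dimension of the algebra of `G_x`-invariant functions. -/
theorem Action.finrank_range_orbitMap [IsAlgClosed k] [Module.Finite k R] (x : A →ₐ[k] k) :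
    Module.finrank k (μ.orbitMap x).range = index k (μ.stabilizerIdeal x) := by
  have hle : (μ.orbitMap x).range ≤ leftInvariants (k := k) (μ.stabilizerIdeal x) := by
    rintro _ ⟨a, rfl⟩
    exact μ.orbitMap_mem_leftInvariants x a
  have hker : ∀ a ∈ RingHom.ker x, μ.orbitMap x a ∈ {a | a ∈ (μ.orbitMap x).range ∧
      Coalgebra.counit (R := k) a = 0} := fun a ha =>
    ⟨⟨a, rfl⟩, by rw [μ.counit_orbitMap]; exact ha⟩
  have hI1 : μ.stabilizerIdeal x = Ideal.span {a | a ∈ (μ.orbitMap x).range ∧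
      Coalgebra.counit (R := k) a = 0} := by
    apply le_antisymm
    · rw [Action.stabilizerIdeal, Ideal.map_le_iff_le_comap]
      exact fun a ha => Ideal.subset_span (hker a ha)
    · rw [Ideal.span_le]
      rintro _ ⟨⟨a, rfl⟩, h0⟩
      refine Ideal.mem_map_of_mem _ ?_
      exact (μ.counit_orbitMap x a).symm.trans h0
  -- Both subalgebras give the same ideal, hence the same second factor in the product formula for
  -- `dim k[G]`; that factor is nonzero and cancels.
  have hI2 : μ.stabilizerIdeal x = Ideal.span
      {a | a ∈ leftInvariants (k := k) (μ.stabilizerIdeal x) ∧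
        Coalgebra.counit (R := k) a = 0} := by
    apply le_antisymm
    · conv_lhs => rw [hI1]
      exact Ideal.span_mono fun a ha => ⟨hle ha.1, ha.2⟩
    · rw [Ideal.span_le]
      rintro a ⟨ha, h0⟩
      exact mem_of_mem_leftInvariants ha h0
  obtain ⟨δ₁, hδ₁⟩ := exists_coact_of_forall_comul_mem_range (C := (μ.orbitMap x).range) (by
    rintro _ ⟨a, rfl⟩
    change comul (R := k) (μ.orbitMap x a) ∈ _
    rw [μ.comul_orbitMap]
    refine ⟨(μ.orbitMap x).rangeRestrict.toLinearMap.rTensor R (μ.coact a), ?_⟩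
    rw [← LinearMap.rTensor_comp_apply]
    rfl)
  obtain ⟨δ₂, hδ₂⟩ := exists_coact_of_forall_comul_mem_range
    (comul_mem_range_of_mem_leftInvariants (k := k) (μ.stabilizerIdeal x))
  have h1 := finrank_eq_finrank_mul_finrank_quotient hδ₁ _ hI1
  have h2 := finrank_eq_finrank_mul_finrank_quotient hδ₂ _ hI2
  have hR : Nontrivial R := Bialgebra.nontrivial (R := k)
  have hpos : 0 < Module.finrank k R := Module.finrank_pos
  rw [h1] at h2
  rw [h1] at hpos
  exact Nat.eq_of_mul_eq_mul_right (Nat.pos_of_mul_pos_left hpos) h2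

end Orbits

/-! ### Norms of functions along the action, and integrality over the invariants. -/

section Frames

open Coalgebra Bialgebra HopfAlgebra Algebra.TensorProduct WithConv

variable {k : Type u₁} {R : Type u₂} {A : Type u₃} [Field k] [CommRing R] [HopfAlgebra k R]
  [CommRing A] [Algebra k A]

section Shear

variable {K : Type*} [CommRing K] [Algebra k K]

/-- The comorphism of `(y, g) ↦ (y, i(y) g)` on `Y × G`, for a morphism `i : Y → G`. -/
noncomputable def shearHom (i : R →ₐ[k] K) : K ⊗[k] R →ₐ[K] K ⊗[k] R :=
  Algebra.TensorProduct.lift (Algebra.ofId K _)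
    (toConv ((includeLeft : K →ₐ[k] K ⊗[k] R).comp i) *
      toConv (includeRight : R →ₐ[k] K ⊗[k] R)).ofConv (fun _ _ => Commute.all _ _)

theorem shearHom_comp (i j : R →ₐ[k] K)
    (hij : toConv i * toConv j = 1) : (shearHom j).comp (shearHom i) = AlgHom.id K (K ⊗[k] R) := by
  have h1 : ((shearHom j).restrictScalars k).comp ((includeLeft : K →ₐ[k] K ⊗[k] R).comp i) =
      (includeLeft : K →ₐ[k] K ⊗[k] R).comp i := by
    ext r
    simp [shearHom, Algebra.ofId_apply, Algebra.TensorProduct.algebraMap_apply]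
  have h2 : ((shearHom j).restrictScalars k).comp (includeRight : R →ₐ[k] K ⊗[k] R) =
      (toConv ((includeLeft : K →ₐ[k] K ⊗[k] R).comp j) *
      toConv (includeRight : R →ₐ[k] K ⊗[k] R)).ofConv := by
    ext r
    simp [shearHom]
  have h3 : toConv ((includeLeft : K →ₐ[k] K ⊗[k] R).comp i) *
      toConv ((includeLeft : K →ₐ[k] K ⊗[k] R).comp j) = 1 := by
    have := AlgHom.comp_convMul_distrib (includeLeft : K →ₐ[k] K ⊗[k] R) (toConv i) (toConv j)
    rw [hij] at this
    apply ofConv_injective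
    refine this.symm.trans ?_
    ext
    simp [AlgHom.convOne_def, Algebra.ofId_apply]
  have h4 := AlgHom.comp_convMul_distrib ((shearHom j).restrictScalars k)
    (toConv ((includeLeft : K →ₐ[k] K ⊗[k] R).comp i)) (toConv (includeRight : R →ₐ[k] K ⊗[k] R))
  dsimp only at h4
  rw [h1, h2, toConv_ofConv, ← mul_assoc, h3, one_mul] at h4
  ext r
  have h5 := DFunLike.congr_fun h4 r
  simpa [shearHom, ← Algebra.TensorProduct.one_def] using h5

theorem toConv_mul_toConv_comp_antipode (i : R →ₐ[k] K) :
    toConv i * toConv (i.comp (antipodeAlgHom k R)) = 1 := by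
  have h := AlgHom.comp_convMul_distrib i (toConv (AlgHom.id k R))
    (toConv (AlgHom.id k R))⁻¹
  rw [mul_inv_cancel] at h
  apply ofConv_injective
  refine h.symm.trans ?_
  ext
  simp [AlgHom.convOne_def, Algebra.ofId_apply]

theorem toConv_comp_antipode_mul_toConv (i : R →ₐ[k] K) :
    toConv (i.comp (antipodeAlgHom k R)) * toConv i = 1 := by
  have h := AlgHom.comp_convMul_distrib i (toConv (AlgHom.id k R))⁻¹
    (toConv (AlgHom.id k R))
  rw [inv_mul_cancel] at h
  apply ofConv_injective
  refine h.symm.trans ?_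
  ext
  simp [AlgHom.convOne_def, Algebra.ofId_apply]

/-- The automorphism `(y, g) ↦ (y, i(y) g)` of `Y × G` over `Y`. -/
noncomputable def shear (i : R →ₐ[k] K) : (K ⊗[k] R) ≃ₐ[K] (K ⊗[k] R) :=
  AlgEquiv.ofAlgHom (shearHom i) (shearHom (i.comp (antipodeAlgHom k R)))
    (shearHom_comp _ _ (toConv_comp_antipode_mul_toConv i))
    (shearHom_comp _ _ (toConv_mul_toConv_comp_antipode i))

end Shear

section Charpoly

variable [Module.Finite k R]

/-- The characteristic polynomial of the multiplication by `z` on the free `A`-module `A ⊗ R`. -/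
noncomputable def tensorCharpoly (z : A ⊗[k] R) : Polynomial A :=
  (Algebra.lmul A (A ⊗[k] R) z).charpoly

theorem tensorCharpoly_eq (z : A ⊗[k] R) : tensorCharpoly z =
    (Algebra.leftMulMatrix (Algebra.TensorProduct.basis A (Module.finBasis k R)) z).charpoly := by
  rw [Algebra.leftMulMatrix_apply, LinearMap.charpoly_toMatrix]
  rfl

theorem tensorCharpoly_map {A' : Type*} [CommRing A'] [Algebra k A'] (φ : A →ₐ[k] A')
    (z : A ⊗[k] R) : tensorCharpoly (Algebra.TensorProduct.map φ (AlgHom.id k R) z) =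
      (tensorCharpoly z).map φ.toRingHom := by
  rw [tensorCharpoly_eq, tensorCharpoly_eq, ← Matrix.charpoly_map]
  congr 1
  ext i j
  rw [Matrix.map_apply, Algebra.leftMulMatrix_eq_repr_mul,
    Algebra.leftMulMatrix_eq_repr_mul]
  induction z using TensorProduct.induction_on with
  | zero => simp
  | add x y hx hy => simp only [map_add, add_mul, hx, hy, Finsupp.add_apply]
  | tmul a s => simp

theorem tensorCharpoly_algEquiv (e : (A ⊗[k] R) ≃ₐ[A] (A ⊗[k] R)) (z : A ⊗[k] R) :
    tensorCharpoly (e z) = tensorCharpoly z := by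
  rw [tensorCharpoly, tensorCharpoly, ← LinearEquiv.charpoly_conj e.toLinearEquiv
    (Algebra.lmul A (A ⊗[k] R) z)]
  congr 1
  refine LinearMap.ext fun w => ?_
  simp [LinearEquiv.conj_apply]

theorem aeval_tensorCharpoly (z : A ⊗[k] R) : Polynomial.aeval z (tensorCharpoly z) = 0 := by
  have h := LinearMap.aeval_self_charpoly (Algebra.lmul A (A ⊗[k] R) z)
  rw [Polynomial.aeval_algHom_apply] at h
  have h1 := LinearMap.congr_fun h 1
  rwa [Algebra.coe_lmul_eq_mul, LinearMap.mul_apply', mul_one] at h1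

theorem tensorCharpoly_coeff_zero_ne_zero {z : k ⊗[k] R} (hz : IsUnit z) :
    (tensorCharpoly z).coeff 0 ≠ 0 := by
  intro h
  have h1 := LinearMap.det_eq_sign_charpoly_coeff (Algebra.lmul k (k ⊗[k] R) z)
  rw [tensorCharpoly] at h
  rw [h, mul_zero] at h1
  have h2 := (hz.map (Algebra.lmul k (k ⊗[k] R))).map LinearMap.det
  rw [h1] at h2
  exact not_isUnit_zero h2

variable (μ : Action k R A)

/-- Coassociativity identifies the base change of `μ.coact s` along the coaction with a shear of its
base change along `a ↦ a ⊗ 1`. A shear preserves characteristic polynomials, so the two base changes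
of each coefficient agree. -/
theorem Action.tensorCharpoly_coact_coeff_mem (s : A) (i : ℕ) :
    (tensorCharpoly (μ.coact s)).coeff i ∈ μ.invariants := by
  have h1 : ∀ z : A ⊗[k] R, shear (includeRight : R →ₐ[k] A ⊗[k] R)
      (Algebra.TensorProduct.map (includeLeft : A →ₐ[k] A ⊗[k] R) (AlgHom.id k R) z) =
      (TensorProduct.assoc k A R R).symm
        (Algebra.TensorProduct.map (AlgHom.id k A) (comulAlgHom k R) z) := by
    intro z
    induction z using TensorProduct.induction_on with
    | zero => simp
    | add x y hx hy => simp only [map_add, hx, hy]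
    | tmul a r =>
      simp only [shear, shearHom, AlgEquiv.ofAlgHom_apply, map_tmul, lift_tmul,
        AlgHom.convMul_apply, AlgHom.coe_id, id_eq, comulAlgHom_apply]
      induction comul (R := k) r using TensorProduct.induction_on with
      | zero => simp
      | add x y hx hy => simp only [map_add, mul_add, TensorProduct.tmul_add, hx, hy]
      | tmul b c => simp [Algebra.ofId_apply, Algebra.TensorProduct.algebraMap_apply]
  have h2 := h1 (μ.coact s)
  rw [← μ.coassoc, LinearEquiv.symm_apply_apply] at h2
  have h3 := tensorCharpoly_map μ.coact (μ.coact s)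
  rw [← h2, tensorCharpoly_algEquiv, tensorCharpoly_map] at h3
  have h4 := congrArg (fun p => Polynomial.coeff p i) h3
  simp only [Polynomial.coeff_map] at h4
  exact h4.symm

/-- Cayley–Hamilton for `μ.coact s`, transported by `id ⊗ ε`, which sends `μ.coact s` to `s`. -/
theorem Action.aeval_tensorCharpoly_coact (s : A) :
    (tensorCharpoly (μ.coact s)).eval s = 0 := by
  let c : A ⊗[k] R →ₐ[A] A := Algebra.TensorProduct.lift (AlgHom.id A A)
    ((Algebra.ofId k A).comp (counitAlgHom k R)) (fun _ _ => Commute.all _ _)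
  have hc : c (μ.coact s) = s := by
    conv_rhs => rw [← μ.counit s]
    induction μ.coact s using TensorProduct.induction_on with
    | zero => simp
    | add x y hx hy => simp only [map_add, hx, hy]
    | tmul a r => simp [c, Algebra.ofId_apply, Algebra.smul_def, mul_comm]
  have h := congrArg c (aeval_tensorCharpoly (μ.coact s))
  rw [← Polynomial.aeval_algHom_apply, hc, map_zero] at h
  simpa using h

instance Action.isIntegral_invariants : Algebra.IsIntegral μ.invariants A := by
  refine ⟨fun s => ?_⟩
  have hlift : tensorCharpoly (μ.coact s) ∈ Polynomial.lifts (algebraMap μ.invariants A) := by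
    rw [Polynomial.lifts_iff_coeff_lifts]
    exact fun i => ⟨⟨_, μ.tensorCharpoly_coact_coeff_mem s i⟩, rfl⟩
  obtain ⟨p, hp, -, hmon⟩ := Polynomial.lifts_and_natDegree_eq_and_monic hlift
    (LinearMap.charpoly_monic _)
  refine ⟨p, hmon, ?_⟩
  rw [← Polynomial.eval_map, hp, μ.aeval_tensorCharpoly_coact]

/-- The constant coefficient is, up to sign, the norm of `s`. Being an invariant multiple of `s`, it
can replace `s` inside any ideal. -/
theorem Action.dvd_tensorCharpoly_coeff_zero (s : A) :
    s ∣ (tensorCharpoly (μ.coact s)).coeff 0 := by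
  have h := μ.aeval_tensorCharpoly_coact s
  rw [← Polynomial.divX_mul_X_add (tensorCharpoly (μ.coact s))] at h
  rw [Polynomial.eval_add, Polynomial.eval_mul, Polynomial.eval_X, Polynomial.eval_C] at h
  exact (dvd_add_right (Dvd.intro_left _ rfl)).1 (h ▸ dvd_zero s)

/-- A function vanishing nowhere on the orbit of `x` pulls back to a unit of `k[G]`, and the norm of
a unit is nonzero. -/
theorem Action.apply_tensorCharpoly_coeff_zero_ne_zero [IsAlgClosed k] (x : A →ₐ[k] k) {s : A}
    (hs : ∀ g : R →ₐ[k] k, μ.translate x g s ≠ 0) :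
    x ((tensorCharpoly (μ.coact s)).coeff 0) ≠ 0 := by
  have hu : IsUnit (μ.orbitMap x s) := by
    by_contra h
    obtain ⟨m, hm, hmem⟩ := exists_max_ideal_of_mem_nonunits h
    obtain ⟨g, rfl⟩ := exists_ker_eq_of_isMaximal (k := k) m
    apply hs g
    rw [← μ.comp_orbitMap]
    exact hmem
  have h1 : Algebra.TensorProduct.lid k R
      (Algebra.TensorProduct.map x (AlgHom.id k R) (μ.coact s)) = μ.orbitMap x s := by
    rw [μ.orbitMap_apply]
    induction μ.coact s using TensorProduct.induction_on with
    | zero => simp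
    | add x y hx hy => simp only [map_add, hx, hy]
    | tmul a r => simp
  rw [← h1, isUnit_map_iff] at hu
  have h2 := tensorCharpoly_coeff_zero_ne_zero hu
  rw [tensorCharpoly_map, Polynomial.coeff_map] at h2
  exact h2

end Charpoly

/-! ### Contractions, local frames and the dual basis. -/

/-- The map `P ⊗ R → P`, `p ⊗ r ↦ χ(r) p`, for a linear map `χ : R → A` and an `A`-module `P`. -/
noncomputable def contract (χ : R →ₗ[k] A) (P : Type*) [AddCommGroup P] [Module k P] [Module A P]
    [IsScalarTower k A P] : P ⊗[k] R →ₗ[k] P :=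
  TensorProduct.lift ((Algebra.lsmul k k P).toLinearMap ∘ₗ χ).flip

@[simp] theorem contract_tmul (χ : R →ₗ[k] A) {P : Type*} [AddCommGroup P] [Module k P]
    [Module A P] [IsScalarTower k A P] (p : P) (r : R) :
    contract χ P (p ⊗ₜ[k] r) = χ r • p := rfl

theorem contract_tmul_one_mul (χ : R →ₗ[k] A) (a : A) (z : A ⊗[k] R) :
    contract χ A (a ⊗ₜ[k] (1 : R) * z) = a * contract χ A z := by
  induction z using TensorProduct.induction_on with
  | zero => simp
  | add x y hx hy => simp only [map_add, mul_add, hx, hy]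
  | tmul b r => simp [mul_left_comm]

theorem contract_add (χ χ' : R →ₗ[k] A) (z : A ⊗[k] R) :
    contract (χ + χ') A z = contract χ A z + contract χ' A z := by
  induction z using TensorProduct.induction_on with
  | zero => simp
  | add x y hx hy => simp only [map_add, hx, hy]; ring
  | tmul b r => simp [add_mul]

theorem contract_smul (c : A) (χ : R →ₗ[k] A) (z : A ⊗[k] R) :
    contract (c • χ) A z = c * contract χ A z := by
  induction z using TensorProduct.induction_on with
  | zero => simp
  | add x y hx hy => simp only [map_add, hx, hy]; ring
  | tmul b r => simp [mul_assoc]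

theorem contract_zero (z : A ⊗[k] R) : contract (0 : R →ₗ[k] A) A z = 0 := by
  simpa using contract_smul (0 : A) (0 : R →ₗ[k] A) z

theorem contract_sum {ι : Type*} (t : Finset ι) (χ : ι → R →ₗ[k] A) (z : A ⊗[k] R) :
    contract (∑ i ∈ t, χ i) A z = ∑ i ∈ t, contract (χ i) A z := by
  classical
  induction t using Finset.induction_on with
  | empty => simp [contract_zero]
  | insert i t hi ih => rw [Finset.sum_insert hi, Finset.sum_insert hi, contract_add, ih]

theorem contract_linearMap_comp (f : Module.Dual k R) (z : A ⊗[k] R) :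
    contract (Algebra.linearMap k A ∘ₗ f) A z = TensorProduct.rid k A (f.lTensor A z) := by
  induction z using TensorProduct.induction_on with
  | zero => simp
  | add x y hx hy => simp only [map_add, hx, hy]
  | tmul b r => simp [Algebra.smul_def]

theorem apply_rid_lTensor (y : A →ₐ[k] k) (f : Module.Dual k R) (z : A ⊗[k] R) :
    y (TensorProduct.rid k A (f.lTensor A z)) = f (evalLeft R y z) := by
  induction z using TensorProduct.induction_on with
  | zero => simp
  | add x y hx hy => simp only [map_add, hx, hy]
  | tmul b r => simp [mul_comm]

theorem eq_zero_of_tmul_one_mul_eq_zero [IsDomain A] {s : A} (hs : s ≠ 0) {z : A ⊗[k] R}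
    (h : s ⊗ₜ[k] (1 : R) * z = 0) : z = 0 := by
  apply eq_zero_of_forall_lTensor_dual
  intro f
  have h1 := congrArg (contract (Algebra.linearMap k A ∘ₗ f) A) h
  rw [contract_tmul_one_mul, contract_linearMap_comp, map_zero] at h1
  exact (mul_eq_zero.1 h1).resolve_left hs

/-- A function on a reduced affine variety which vanishes at all rational points is zero. -/
theorem eq_zero_of_forall_algHom_eq_zero [IsAlgClosed k] [IsReduced A] [Algebra.FiniteType k A]
    {c : A} (h : ∀ y : A →ₐ[k] k, y c = 0) : c = 0 := by
  have := isJacobsonRing_of_finiteType (A := k) (B := A)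
  have h1 : (⊥ : Ideal A).jacobson = ⊥ := IsJacobsonRing.out' _ Ideal.isRadical_bot
  rw [← Ideal.mem_bot, ← h1, Ideal.jacobson, Ideal.mem_sInf]
  rintro m ⟨-, hm⟩
  obtain ⟨y, rfl⟩ := exists_ker_eq_of_isMaximal (k := k) m
  exact h y

theorem eq_zero_of_forall_evalLeft [IsAlgClosed k] [IsReduced A] [Algebra.FiniteType k A]
    {z : A ⊗[k] R} (h : ∀ y : A →ₐ[k] k, evalLeft R y z = 0) : z = 0 := by
  apply eq_zero_of_forall_lTensor_dual
  intro f
  apply eq_zero_of_forall_algHom_eq_zero (k := k)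
  intro y
  rw [apply_rid_lTensor, h, map_zero]

variable (μ : Action k R A)

/-- The linear maps `χ i` express the coactions of all functions, multiplied by `s`, as
combinations of the coactions of the `a i`. -/
structure Action.IsLocalFrame {d : ℕ} (s : A) (a : Fin d → A) (χ : Fin d → R →ₗ[k] A) : Prop where
  contract_coact : ∀ i l, contract (χ i) A (μ.coact (a l)) = if l = i then s else 0
  tmul_mul_coact : ∀ b, s ⊗ₜ[k] (1 : R) * μ.coact b =
    ∑ i, contract (χ i) A (μ.coact b) ⊗ₜ[k] (1 : R) * μ.coact (a i)

/-- The values of the linear forms `l j` on the coactions of the functions `a i`. -/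
noncomputable def Action.coactMatrix {d : ℕ} (a : Fin d → A) (l : Fin d → Module.Dual k R) :
    Matrix (Fin d) (Fin d) A :=
  Matrix.of fun i j => TensorProduct.rid k A ((l j).lTensor A (μ.coact (a i)))

/-- Cramer's rule: the `χ i` come from the adjugate. Where the determinant is nonzero at `y`, the
orbit functions of the `a i` are independent, hence a basis because the orbit image has dimension
exactly `d`, and the expansion holds at `y`. Multiplying by the determinant makes it hold at every
point; Nullstellensatz and cancellation in a domain finish. -/
theorem Action.exists_isLocalFrame_det [IsAlgClosed k] [Module.Finite k R] [IsDomain A]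
    [Algebra.FiniteType k A] {d : ℕ}
    (hd : ∀ y : A →ₐ[k] k, Module.finrank k (μ.orbitMap y).range = d) (a : Fin d → A)
    (l : Fin d → Module.Dual k R) :
    ∃ χ, μ.IsLocalFrame (μ.coactMatrix a l).det a χ := by
  set M := μ.coactMatrix a l with hM
  by_cases hs : M.det = 0
  · exact ⟨fun _ => 0, fun i l => by simp [contract_zero, hs],
      fun b => by simp [contract_zero, hs]⟩
  let χ : Fin d → R →ₗ[k] A := fun i =>
    ∑ j, M.adjugate j i • (Algebra.linearMap k A ∘ₗ l j)
  have hχ : ∀ i z, contract (χ i) A z = ∑ j, M.adjugate j i *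
      TensorProduct.rid k A ((l j).lTensor A z) := by
    intro i z
    simp only [χ, contract_sum, contract_smul, contract_linearMap_comp]
  have h1 : ∀ i l, contract (χ i) A (μ.coact (a l)) = if l = i then M.det else 0 := by
    intro i l
    have := congrFun (congrFun M.mul_adjugate l) i
    rw [Matrix.smul_apply, Matrix.one_apply, Matrix.mul_apply, smul_eq_mul, mul_ite, mul_one,
      mul_zero] at this
    rw [hχ, ← this]
    exact Finset.sum_congr rfl fun j _ => mul_comm _ _
  refine ⟨χ, h1, fun b => sub_eq_zero.1 ?_⟩
  apply eq_zero_of_tmul_one_mul_eq_zero hs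
  apply eq_zero_of_forall_evalLeft
  intro y
  by_cases hy : y M.det = 0
  · rw [map_mul, evalLeft_tmul, hy, zero_smul, zero_mul]
  let F : Fin d → Module.Dual k R := fun i => ∑ j, y (M.adjugate j i) • l j
  have hF : ∀ i z, y (contract (χ i) A z) = F i (evalLeft R y z) := by
    intro i z
    simp [hχ, F, apply_rid_lTensor]
  have hF1 : ∀ i l, F i (μ.orbitMap y (a l)) = if l = i then y M.det else 0 := by
    intro i l
    rw [μ.orbitMap_apply, ← hF, h1]
    split_ifs <;> simp
  have hFc : ∀ (c : Fin d → k) i, F i (∑ l, c l • μ.orbitMap y (a l)) = c i * y M.det := by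
    intro c i
    simp [hF1]
  have hli : LinearIndependent k fun l => μ.orbitMap y (a l) := by
    rw [Fintype.linearIndependent_iff]
    intro c hc i
    have := hFc c i
    rw [hc, map_zero] at this
    exact (mul_eq_zero.1 this.symm).resolve_right hy
  have hspan : Submodule.span k (Set.range fun l => μ.orbitMap y (a l)) =
      Subalgebra.toSubmodule (μ.orbitMap y).range := by
    apply Submodule.eq_of_le_of_finrank_eq
    · rw [Submodule.span_le]
      rintro _ ⟨l, rfl⟩
      exact ⟨a l, rfl⟩
    · rw [finrank_span_eq_card hli, Fintype.card_fin]
      exact (hd y).symm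
  have hb : μ.orbitMap y b ∈ Submodule.span k (Set.range fun l => μ.orbitMap y (a l)) := by
    rw [hspan]
    exact ⟨b, rfl⟩
  obtain ⟨c, hc⟩ := (Submodule.mem_span_range_iff_exists_fun k).1 hb
  have hc' : ∀ i, y (contract (χ i) A (μ.coact b)) = c i * y M.det := by
    intro i
    rw [hF, ← μ.orbitMap_apply, ← hc, hFc]
  simp only [map_mul, map_sub, map_sum, evalLeft_tmul, ← μ.orbitMap_apply, hc', ← hc]
  rw [sub_eq_zero.2, mul_zero]
  rw [Finset.mul_sum]
  refine Finset.sum_congr rfl fun i _ => ?_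
  rw [smul_one_mul, smul_one_mul, smul_smul, mul_comm]

/-- For fixed `a` the defining identities are jointly linear in `s` and `χ`, so the admissible `s`
form an ideal. -/
theorem Action.exists_isLocalFrame_of_mem_span {d : ℕ} {a : Fin d → A} {S : Set A}
    (hS : ∀ s ∈ S, ∃ χ, μ.IsLocalFrame s a χ) {s : A} (hs : s ∈ Ideal.span S) :
    ∃ χ, μ.IsLocalFrame s a χ := by
  induction hs using Submodule.span_induction with
  | mem s hs => exact hS s hs
  | zero => exact ⟨fun _ => 0, fun i l => by simp [contract_zero],
      fun b => by simp [contract_zero]⟩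
  | add s t _ _ hs ht =>
    obtain ⟨χ, h⟩ := hs
    obtain ⟨χ', h'⟩ := ht
    refine ⟨fun i => χ i + χ' i, fun i l => ?_, fun b => ?_⟩
    · rw [contract_add, h.contract_coact, h'.contract_coact]
      split_ifs <;> simp
    · simp only [contract_add, TensorProduct.add_tmul, add_mul, Finset.sum_add_distrib,
        h.tmul_mul_coact, h'.tmul_mul_coact]
  | smul c s _ hs =>
    obtain ⟨χ, h⟩ := hs
    have hc : ∀ t : A, (c * t) ⊗ₜ[k] (1 : R) = c ⊗ₜ[k] (1 : R) * t ⊗ₜ[k] (1 : R) := fun t => by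
      simp
    refine ⟨fun i => c • χ i, fun i l => ?_, fun b => ?_⟩
    · rw [contract_smul, h.contract_coact]
      split_ifs <;> simp
    · simp only [contract_smul, hc, smul_eq_mul, mul_assoc, ← Finset.mul_sum, h.tmul_mul_coact]

theorem Action.exists_invariant_isLocalFrame [IsAlgClosed k] [Module.Finite k R] [IsDomain A]
    [Algebra.FiniteType k A] {d : ℕ}
    (hd : ∀ y : A →ₐ[k] k, Module.finrank k (μ.orbitMap y).range = d) (x : A →ₐ[k] k) :
    ∃ s ∈ μ.invariants, x s ≠ 0 ∧ ∃ a : Fin d → A, ∃ χ, μ.IsLocalFrame s a χ := by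
  let b := Module.finBasisOfFinrankEq k (μ.orbitMap x).range (hd x)
  choose a ha using fun i => (b i).2
  have hli : LinearIndependent k fun i => μ.orbitMap x (a i) := by
    have h1 : (fun i => μ.orbitMap x (a i)) = (μ.orbitMap x).range.val.toLinearMap ∘ b :=
      funext ha
    rw [h1]
    exact b.linearIndependent.map' _ (LinearMap.ker_eq_bot.2 Subtype.val_injective)
  -- No point of the orbit of `x` is a zero of `J`, as the `a i` stay independent there. `G` has
  -- finitely many rational points, so prime avoidance finds one `s` in `J` nonvanishing on the
  -- whole orbit; its norm is the invariant denominator sought.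
  let J : Ideal A := Ideal.span (Set.range fun l => (μ.coactMatrix a l).det)
  have hJ : ∀ g : R →ₐ[k] k, ¬ J ≤ RingHom.ker (μ.translate x g) := by
    intro g hle
    have hli' : LinearIndependent k fun i => μ.orbitMap (μ.translate x g) (a i) := by
      simp only [μ.orbitMap_translate]
      exact hli.map' (leftTranslation g).toLinearMap
        (LinearMap.ker_eq_bot.2 (leftTranslation_injective g))
    obtain ⟨f, hf⟩ := LinearMap.exists_leftInverse_of_injective
      (Fintype.linearCombination k fun i => μ.orbitMap (μ.translate x g) (a i))
      (LinearMap.ker_eq_bot.2 hli'.fintypeLinearCombination_injective)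
    let l : Fin d → Module.Dual k R := fun j => LinearMap.proj j ∘ₗ f
    have h1 : (μ.translate x g) (μ.coactMatrix a l).det = 0 :=
      hle (Ideal.subset_span ⟨l, rfl⟩)
    have h2 : (μ.translate x g).toRingHom.mapMatrix (μ.coactMatrix a l) = 1 := by
      ext i j
      have h3 := congrFun (LinearMap.congr_fun hf (Pi.single i 1)) j
      simp only [LinearMap.comp_apply, Fintype.linearCombination_apply_single, one_smul,
        LinearMap.id_apply] at h3
      rw [RingHom.mapMatrix_apply, Matrix.map_apply]
      refine (apply_rid_lTensor (μ.translate x g) (l j) _).trans (h3.trans ?_)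
      rw [Matrix.one_apply, Pi.single_apply]
      simp [eq_comm]
    have h4 := RingHom.map_det (μ.translate x g).toRingHom (μ.coactMatrix a l)
    rw [h2, Matrix.det_one] at h4
    exact one_ne_zero (h4.symm.trans h1)
  obtain ⟨s, hsJ, hs⟩ : ∃ s ∈ J, ∀ g : R →ₐ[k] k, μ.translate x g s ≠ 0 := by
    by_contra! hcon
    have := Fintype.ofFinite (R →ₐ[k] k)
    let g₀ := counitAlgHom k R
    obtain ⟨g, -, hg⟩ := (Ideal.subset_union_prime (s := Finset.univ)
      (f := fun g : R →ₐ[k] k => RingHom.ker (μ.translate x g)) g₀ g₀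
      (fun g _ _ _ => RingHom.ker_isPrime _) (I := J)).1 (by
        intro s hs
        obtain ⟨g, hg⟩ := hcon s hs
        simp only [Set.mem_iUnion]
        exact ⟨g, by simp, hg⟩)
    exact hJ g hg
  refine ⟨_, μ.tensorCharpoly_coact_coeff_mem s 0,
    μ.apply_tensorCharpoly_coeff_zero_ne_zero x hs, a, ?_⟩
  refine μ.exists_isLocalFrame_of_mem_span (S := Set.range fun l => (μ.coactMatrix a l).det) ?_
    (J.mem_of_dvd (μ.dvd_tensorCharpoly_coeff_zero s) hsJ)
  rintro _ ⟨l, rfl⟩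
  exact μ.exists_isLocalFrame_det hd a l

/-- Uniqueness of coefficients. Apply `μ.coact ⊗ id` and `id ⊗ Δ` to the expansion of `b`: by
coassociativity they agree on coactions, so the difference is a relation with coefficients `μ.coact
c - c ⊗ 1`. Contracting it with `μ.coact ∘ χ i` isolates the `i`-th one, multiplied by `s ⊗ 1`. -/
theorem Action.IsLocalFrame.contract_mem_invariants {μ : Action k R A} [IsDomain A] {d : ℕ} {s : A}
    {a : Fin d → A} {χ : Fin d → R →ₗ[k] A} (h : μ.IsLocalFrame s a χ) (hs : s ∈ μ.invariants)
    (hs0 : s ≠ 0) (i : Fin d) (b : A) : contract (χ i) A (μ.coact b) ∈ μ.invariants := by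
  have hs' : μ.coact s = s ⊗ₜ 1 := hs
  let X : A ⊗[k] R →ₐ[k] (A ⊗[k] R) ⊗[k] R := Algebra.TensorProduct.map μ.coact (AlgHom.id k R)
  let T : A ⊗[k] R →ₐ[k] (A ⊗[k] R) ⊗[k] R :=
    (Algebra.TensorProduct.assoc k k k A R R).symm.toAlgHom.comp
      (Algebra.TensorProduct.map (AlgHom.id k A) (comulAlgHom k R))
  have hXT : ∀ c, T (μ.coact c) = X (μ.coact c) := by
    intro c
    change (TensorProduct.assoc k A R R).symm _ = _
    rw [LinearEquiv.symm_apply_eq, μ.coassoc]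
    rfl
  have hX1 : ∀ c : A, X (c ⊗ₜ 1) = μ.coact c ⊗ₜ 1 := fun c => by simp [X]
  have hT1 : ∀ c : A, T (c ⊗ₜ 1) = (c ⊗ₜ 1) ⊗ₜ 1 := fun c => by
    simp [T, Algebra.TensorProduct.one_def]
  have h1 := congrArg X (h.tmul_mul_coact b)
  have h2 := congrArg T (h.tmul_mul_coact b)
  simp only [map_mul, map_sum, hXT, hX1, hT1, hs'] at h1 h2
  have h3 := h1.symm.trans h2
  rw [← sub_eq_zero, ← Finset.sum_sub_distrib] at h3
  simp only [← sub_mul, ← TensorProduct.sub_tmul] at h3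
  let c : (A ⊗[k] R) ⊗[k] R →ₗ[k] A ⊗[k] R :=
    TensorProduct.lift ((LinearMap.mul k (A ⊗[k] R)).compl₂ (μ.coact.toLinearMap ∘ₗ χ i))
  have hc : ∀ (z : A ⊗[k] R) (r : R), c (z ⊗ₜ r) = z * μ.coact (χ i r) := fun _ _ => rfl
  have hcX : ∀ (z w : A ⊗[k] R), c (z ⊗ₜ 1 * X w) = z * μ.coact (contract (χ i) A w) := by
    intro z w
    induction w using TensorProduct.induction_on with
    | zero => simp
    | add x y hx hy => simp only [map_add, mul_add, hx, hy]
    | tmul b r => simp [X, hc, mul_assoc, mul_comm (μ.coact (χ i r))]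
  have h4 := congrArg c h3
  simp only [map_sum, hcX, h.contract_coact, apply_ite μ.coact, map_zero, hs', mul_ite, mul_zero,
    Finset.sum_ite_eq', Finset.mem_univ, if_true] at h4
  rw [mul_comm] at h4
  exact sub_eq_zero.1 (eq_zero_of_tmul_one_mul_eq_zero hs0 h4)

/-- Apply the counit to the second factor of the frame identity. -/
theorem Action.IsLocalFrame.sum_contract_mul {μ : Action k R A} {d : ℕ} {s : A}
    {a : Fin d → A} {χ : Fin d → R →ₗ[k] A} (h : μ.IsLocalFrame s a χ) (b : A) :
    ∑ i, contract (χ i) A (μ.coact b) * a i = s * b := by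
  have h1 : ∀ c t, TensorProduct.rid k A ((Coalgebra.counit (R := k) (A := R)).lTensor A
      (t ⊗ₜ[k] (1 : R) * μ.coact c)) = t * c := by
    intro c t
    rw [← contract_linearMap_comp, contract_tmul_one_mul, contract_linearMap_comp, μ.counit]
  have h2 := congrArg (fun z => TensorProduct.rid k A
    ((Coalgebra.counit (R := k) (A := R)).lTensor A z)) (h.tmul_mul_coact b)
  simp only [map_sum, h1] at h2
  exact h2.symm

/-- If all orbits have the same dimension, `A` has a dual basis over `A^G` whose forms are given
by contractions of the coaction, and `A^G` is a direct summand of `A` in the same manner. -/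
theorem Action.exists_dualBasis [IsAlgClosed k] [Module.Finite k R] [IsDomain A]
    [Algebra.FiniteType k A] {d : ℕ}
    (hd : ∀ y : A →ₐ[k] k, Module.finrank k (μ.orbitMap y).range = d) :
    ∃ (n : ℕ) (a : Fin n → A) (χ : Fin n → R →ₗ[k] A) (ρ : R →ₗ[k] A),
      (∀ i b, contract (χ i) A (μ.coact b) ∈ μ.invariants) ∧
      (∀ b, contract ρ A (μ.coact b) ∈ μ.invariants) ∧
      (∀ b, ∑ i, contract (χ i) A (μ.coact b) * a i = b) ∧ ρ 1 = 1 := by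
  choose s hs hs0 a χ hf using μ.exists_invariant_isLocalFrame hd
  have hs1 : ∀ x, s x ≠ 0 := fun x h => hs0 x (by rw [h, map_zero])
  have hinj : Function.Injective (algebraMap μ.invariants A) := Subtype.val_injective
  -- By integrality and the Nullstellensatz every maximal ideal of `A^G` lies below a rational point
  -- of `X`.
  have hpoint : ∀ F : Ideal μ.invariants, (∀ x : A →ₐ[k] k, ∃ c ∈ F, x (c : A) ≠ 0) → F = ⊤ := by
    intro F hF
    by_contra hne
    obtain ⟨M, hM, hle⟩ := Ideal.exists_le_maximal _ hne
    obtain ⟨Q, hQ, hQM⟩ := Ideal.exists_ideal_over_maximal_of_isIntegral (S := A) M (by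
      rw [(RingHom.injective_iff_ker_eq_bot _).1 hinj]
      exact bot_le)
    obtain ⟨x, rfl⟩ := exists_ker_eq_of_isMaximal (k := k) Q
    obtain ⟨c, hc, hxc⟩ := hF x
    have h1 := hle hc
    rw [← hQM] at h1
    exact hxc h1
  have htop := hpoint (Ideal.span (Set.range fun x => (⟨s x, hs x⟩ : μ.invariants)))
    fun x => ⟨_, Ideal.subset_span ⟨x, rfl⟩, hs0 x⟩
  rw [Ideal.eq_top_iff_one, Ideal.span, Finsupp.mem_span_range_iff_exists_finsupp] at htop
  obtain ⟨c, hc⟩ := htop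
  have hc' : ∑ x ∈ c.support, (c x : A) * s x = 1 := by
    have := congrArg (algebraMap μ.invariants A) hc
    simpa [Finsupp.sum] using! this
  let e := Fintype.equivFin (c.support × Fin d)
  let a' : Fin (Fintype.card (c.support × Fin d)) → A := fun i => a (e.symm i).1 (e.symm i).2
  let χ' : Fin (Fintype.card (c.support × Fin d)) → R →ₗ[k] A := fun i =>
    (c (e.symm i).1 : A) • χ (e.symm i).1 (e.symm i).2
  have hmem : ∀ i b, contract (χ' i) A (μ.coact b) ∈ μ.invariants := by
    intro i b
    rw [contract_smul]
    exact mul_mem (Subtype.mem _) ((hf _).contract_mem_invariants (hs _) (hs1 _) _ _)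
  have hsum : ∀ b, ∑ i, contract (χ' i) A (μ.coact b) * a' i = b := by
    intro b
    rw [← e.sum_comp]
    simp only [χ', a', Equiv.symm_apply_apply, contract_smul, Fintype.sum_prod_type, mul_assoc,
      ← Finset.mul_sum, (hf _).sum_contract_mul]
    rw [Finset.sum_coe_sort c.support (fun x => (c x : A) * (s x * b))]
    simp only [← mul_assoc, ← Finset.sum_mul, hc', one_mul]
  -- Expanding `1` in the dual basis shows that the values of the forms at `1` have no common zero.
  -- A combination of the forms with invariant coefficients therefore takes the value one at `1`,
  -- which gives `ρ`.
  have htop' := hpoint (Ideal.span (Set.range fun i =>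
    (⟨contract (χ' i) A (μ.coact 1), hmem i 1⟩ : μ.invariants))) (by
      intro x
      by_contra! hcon
      have h1 := congrArg x (hsum 1)
      rw [map_sum, map_one x] at h1
      refine one_ne_zero (α := k) (h1.symm.trans (Finset.sum_eq_zero fun i _ => ?_))
      rw [map_mul, hcon _ (Ideal.subset_span ⟨i, rfl⟩), zero_mul])
  rw [Ideal.eq_top_iff_one, Ideal.span, Submodule.mem_span_range_iff_exists_fun] at htop'
  obtain ⟨β, hβ⟩ := htop'
  have hρ : ∀ b, contract (∑ i, (β i : A) • χ' i) A (μ.coact b) =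
      ∑ i, (β i : A) * contract (χ' i) A (μ.coact b) := by
    intro b
    simp only [contract_sum, contract_smul]
  refine ⟨_, a', χ', ∑ i, (β i : A) • χ' i, hmem, fun b => ?_, hsum, ?_⟩
  · rw [hρ]
    exact sum_mem fun i _ => mul_mem (Subtype.mem _) (hmem i b)
  · have h1 := congrArg (algebraMap μ.invariants A) hβ
    have h2 : ∀ χ : R →ₗ[k] A, contract χ A (μ.coact 1) = χ 1 := by
      intro χ
      rw [map_one, Algebra.TensorProduct.one_def, contract_tmul, smul_eq_mul, mul_one]
    rw [← h2, hρ]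
    simpa only [map_sum, map_one] using! h1

end Frames

/-! ### Consequences of the dual basis for `(A, G)`-modules. -/

section Modules

variable {k : Type u₁} {R : Type u₂} {A : Type u₃} [Field k] [CommRing R] [HopfAlgebra k R]
  [CommRing A] [Algebra k A] {μ : Action k R A}

/-- The form `A → A^G`, `b ↦ χ(b_(1)) b_(0)`, for a suitable `χ : k[G] → A`. -/
noncomputable def Action.invariantForm {χ : R →ₗ[k] A}
    (hχ : ∀ b, contract χ A (μ.coact b) ∈ μ.invariants) : A →ₗ[μ.invariants] μ.invariants where
  toFun b := ⟨_, hχ b⟩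
  map_add' b c := by simp
  map_smul' c b := by
    have hc : μ.coact (c : A) = (c : A) ⊗ₜ 1 := c.2
    ext
    simp [Subalgebra.smul_def, hc, contract_tmul_one_mul]

@[simp] theorem Action.coe_invariantForm {χ : R →ₗ[k] A}
    (hχ : ∀ b, contract χ A (μ.coact b) ∈ μ.invariants) (b : A) :
    (Action.invariantForm hχ b : A) = contract χ A (μ.coact b) := rfl

/-- The operator `m ↦ χ(m_(1)) m_(0)` on an `(A, G)`-module. -/
noncomputable def AGModule.contractCoact (M : AGModule.{w} μ) (χ : R →ₗ[k] A) : M →ₗ[k] M :=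
  contract χ M ∘ₗ M.coact

/-- On products with invariant elements the operator only sees the form on `A`; this transfers the
dual basis from `A` to modules generated by invariants. -/
theorem AGModule.contractCoact_smul (M : AGModule.{w} μ) (χ : R →ₗ[k] A) (b : A) {m : M}
    (hm : m ∈ M.invariants) : M.contractCoact χ (b • m) = contract χ A (μ.coact b) • m := by
  rw [AGModule.mem_invariants] at hm
  rw [AGModule.contractCoact, LinearMap.comp_apply, M.coact_smul, hm]
  induction μ.coact b using TensorProduct.induction_on with
  | zero => simp
  | add x y hx hy => simp only [map_add, LinearMap.add_apply, hx, hy, add_smul]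
  | tmul c r => simp [mul_smul]

theorem AGModule.contractCoact_of_mem (M : AGModule.{w} μ) (χ : R →ₗ[k] A) {m : M}
    (hm : m ∈ M.invariants) : M.contractCoact χ m = χ 1 • m := by
  rw [AGModule.mem_invariants] at hm
  rw [AGModule.contractCoact, LinearMap.comp_apply, hm, contract_tmul]

theorem AGModule.contractCoact_invariants_smul (M : AGModule.{w} μ) (χ : R →ₗ[k] A)
    (c : μ.invariants) (m : M) : M.contractCoact χ (c • m) = c • M.contractCoact χ m := by
  have hc : μ.coact (c : A) = (c : A) ⊗ₜ 1 := c.2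
  rw [AGModule.contractCoact, LinearMap.comp_apply, LinearMap.comp_apply, Subalgebra.smul_def,
    Subalgebra.smul_def, M.coact_smul, hc]
  induction M.coact m using TensorProduct.induction_on with
  | zero => simp
  | add x y hx hy => simp only [map_add, smul_add, hx, hy]
  | tmul n r => simp [smul_smul, mul_comm]

theorem AGModule.Hom.map_contractCoact {M N : AGModule.{w} μ} (f : AGModule.Hom M N)
    (χ : R →ₗ[k] A) (m : M) :
    f.toLinearMap (M.contractCoact χ m) = N.contractCoact χ (f.toLinearMap m) := by
  rw [AGModule.contractCoact, AGModule.contractCoact, LinearMap.comp_apply, LinearMap.comp_apply,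
    f.coact_apply]
  induction M.coact m using TensorProduct.induction_on with
  | zero => simp
  | add x y hx hy => simp only [map_add, hx, hy]
  | tmul n r => simp

theorem AGModule.Hom.map_mem_invariants {M N : AGModule.{w} μ} (f : AGModule.Hom M N) {m : M}
    (hm : m ∈ M.invariants) : f.toLinearMap m ∈ N.invariants := by
  rw [AGModule.mem_invariants] at hm ⊢
  rw [f.coact_apply, hm]
  rfl

/-- Tensoring with `R` over the field keeps the map injective. -/
theorem AGModule.Hom.mem_invariants_of_injective {M N : AGModule.{w} μ} (f : AGModule.Hom M N)
    (hf : Function.Injective f.toLinearMap) {m : M} (hm : f.toLinearMap m ∈ N.invariants) :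
    m ∈ M.invariants := by
  rw [AGModule.mem_invariants] at hm ⊢
  rw [f.coact_apply] at hm
  exact Module.Flat.rTensor_preserves_injective_linearMap (M := R)
    (f.toLinearMap.restrictScalars k) hf hm

/-- The multiplication `A ⊗_{A^G} M^G → M`. -/
noncomputable def AGModule.invariantsMul (M : AGModule.{w} μ) :
    A ⊗[μ.invariants] M.invariants →ₗ[A] M :=
  TensorProduct.AlgebraTensorModule.lift
    { toFun := fun a => a • M.invariants.subtype
      map_add' := fun a b => add_smul a b _
      map_smul' := fun c a => by
        ext m
        simp [mul_smul] }

@[simp] theorem AGModule.invariantsMul_tmul (M : AGModule.{w} μ) (a : A) (m : M.invariants) :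
    M.invariantsMul (a ⊗ₜ m) = a • (m : M) := rfl

theorem AGModule.invariantsMul_surjective {M : AGModule.{w} μ}
    (hM : generatedByInvariants μ M) : Function.Surjective M.invariantsMul := by
  rw [← LinearMap.range_eq_top, ← top_le_iff, ← (show Submodule.span A _ = ⊤ from hM),
    Submodule.span_le]
  intro m hm
  exact ⟨1 ⊗ₜ ⟨m, hm⟩, by simp⟩

theorem AGModule.contractCoact_mem_invariants {M : AGModule.{w} μ}
    (hM : generatedByInvariants μ M) {χ : R →ₗ[k] A}
    (hχ : ∀ b, contract χ A (μ.coact b) ∈ μ.invariants) (m : M) :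
    M.contractCoact χ m ∈ M.invariants := by
  obtain ⟨t, rfl⟩ := AGModule.invariantsMul_surjective hM m
  induction t using TensorProduct.induction_on with
  | zero => simp
  | add x y hx hy => rw [map_add, map_add]; exact add_mem hx hy
  | tmul b m =>
    rw [AGModule.invariantsMul_tmul, M.contractCoact_smul χ b m.2]
    exact M.invariants.smul_mem ⟨_, hχ b⟩ m.2

theorem AGModule.sum_smul_contractCoact {M : AGModule.{w} μ}
    (hM : generatedByInvariants μ M) {n : ℕ} {a : Fin n → A} {χ : Fin n → R →ₗ[k] A}
    (hsum : ∀ b, ∑ i, contract (χ i) A (μ.coact b) * a i = b) (m : M) :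
    ∑ i, a i • M.contractCoact (χ i) m = m := by
  obtain ⟨t, rfl⟩ := AGModule.invariantsMul_surjective hM m
  induction t using TensorProduct.induction_on with
  | zero => simp
  | add x y hx hy => simp only [map_add, smul_add, Finset.sum_add_distrib, hx, hy]
  | tmul b m =>
    simp only [AGModule.invariantsMul_tmul, M.contractCoact_smul _ b m.2, smul_smul,
      ← Finset.sum_smul]
    simp only [mul_comm (a _), hsum]

/-- The formula `m = ∑ a i • χ i (m)` holds in `M`, and its terms come from `N` because the
operators commute with `f`. Invariance of `χ i (m)` is also detected in `M`. -/
theorem generatedByInvariants_of_injective {M N : AGModule.{w} μ} (f : AGModule.Hom N M)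
    (hf : Function.Injective f.toLinearMap) (hM : generatedByInvariants μ M) {n : ℕ}
    {a : Fin n → A} {χ : Fin n → R →ₗ[k] A}
    (hχ : ∀ i b, contract (χ i) A (μ.coact b) ∈ μ.invariants)
    (hsum : ∀ b, ∑ i, contract (χ i) A (μ.coact b) * a i = b) : generatedByInvariants μ N := by
  refine (Submodule.eq_top_iff').2 fun m => ?_
  have h1 : m = ∑ i, a i • N.contractCoact (χ i) m := by
    apply hf
    simp only [map_sum, map_smul, f.map_contractCoact]
    exact (AGModule.sum_smul_contractCoact hM hsum _).symm
  rw [h1]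
  refine Submodule.sum_mem _ fun i _ => Submodule.smul_mem _ _ (Submodule.subset_span ?_)
  refine f.mem_invariants_of_injective hf ?_
  rw [f.map_contractCoact]
  exact AGModule.contractCoact_mem_invariants hM (hχ i) _

theorem generatedByInvariants_of_surjective {M N : AGModule.{w} μ} (f : AGModule.Hom M N)
    (hf : Function.Surjective f.toLinearMap) (hM : generatedByInvariants μ M) :
    generatedByInvariants μ N := by
  have h1 : (Submodule.span A (M.invariants : Set M)).map f.toLinearMap = ⊤ := by
    rw [show Submodule.span A _ = ⊤ from hM, Submodule.map_top, LinearMap.range_eq_top.2 hf]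
  rw [Submodule.map_span] at h1
  refine top_le_iff.1 (h1.ge.trans (Submodule.span_mono ?_))
  rintro _ ⟨m, hm, rfl⟩
  exact f.map_mem_invariants hm

/-- A tensor is recovered from its product: `t = ∑ a i ⊗ χ i (t)`, where `χ i (t)` depends only on
the image of `t` in `M`. -/
theorem AGModule.invariantsMul_injective (M : AGModule.{w} μ) {n : ℕ} {a : Fin n → A}
    {χ : Fin n → R →ₗ[k] A} (hχ : ∀ i b, contract (χ i) A (μ.coact b) ∈ μ.invariants)
    (hsum : ∀ b, ∑ i, contract (χ i) A (μ.coact b) * a i = b) :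
    Function.Injective M.invariantsMul := by
  have h1 : ∀ t i, M.contractCoact (χ i) (M.invariantsMul t) =
      ((TensorProduct.lid _ _ ((Action.invariantForm (hχ i)).rTensor _ t) : M.invariants) : M) := by
    intro t i
    induction t using TensorProduct.induction_on with
    | zero => simp
    | add x y hx hy => simp only [map_add, hx, hy, Submodule.coe_add]
    | tmul b m =>
      rw [AGModule.invariantsMul_tmul, M.contractCoact_smul _ b m.2]
      rfl
  have h2 : ∀ t : A ⊗[μ.invariants] M.invariants, t = ∑ i, a i ⊗ₜ[μ.invariants]
      (TensorProduct.lid _ _ ((Action.invariantForm (hχ i)).rTensor _ t) : M.invariants) := by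
    intro t
    induction t using TensorProduct.induction_on with
    | zero => simp
    | add x y hx hy =>
      simp only [map_add, TensorProduct.tmul_add, Finset.sum_add_distrib]
      rw [← hx, ← hy]
    | tmul b m =>
      conv_lhs => rw [← hsum b, TensorProduct.sum_tmul]
      refine Finset.sum_congr rfl fun i _ => ?_
      rw [LinearMap.rTensor_tmul, TensorProduct.lid_tmul, ← TensorProduct.smul_tmul]
      rfl
  refine (injective_iff_map_eq_zero _).2 fun t ht => ?_
  rw [h2 t]
  refine Finset.sum_eq_zero fun i _ => ?_
  have h3 := h1 t i
  rw [ht, map_zero] at h3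
  rw [(Submodule.coe_eq_zero.1 h3.symm), TensorProduct.tmul_zero]

/-- The map `N → (A ⊗_{A^G} N)^G`, `n ↦ 1 ⊗ n`. -/
noncomputable def extendUnit (μ : Action k R A) (N : Type (max v u₃)) [AddCommGroup N]
    [Module μ.invariants N] : N →ₗ[μ.invariants] (Action.extend.{v} μ N).invariants :=
  LinearMap.codRestrict _ (TensorProduct.mk μ.invariants A N 1) fun n => by
    change μ.extendCoact N (1 ⊗ₜ n) = (1 ⊗ₜ n) ⊗ₜ (1 : R)
    rw [μ.extendCoact_tmul, map_one, Algebra.TensorProduct.one_def, LinearMap.rTensor_tmul,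
      μ.tmulRight_apply]

/-- The form given by `ρ` retracts `A ⊗ N` onto `N`, which gives injectivity. The operator of `ρ`
fixes invariant tensors since `ρ 1 = 1`, and it maps every `t` to some `1 ⊗ n`. -/
theorem extendUnit_bijective {ρ : R →ₗ[k] A}
    (hρ : ∀ b, contract ρ A (μ.coact b) ∈ μ.invariants) (hρ1 : ρ 1 = 1)
    (N : Type (max v u₃)) [AddCommGroup N] [Module μ.invariants N] :
    Function.Bijective (extendUnit.{v} μ N) := by
  have hf1 : Action.invariantForm hρ 1 = 1 := by
    ext
    rw [Action.coe_invariantForm, map_one, Algebra.TensorProduct.one_def, contract_tmul, hρ1]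
    simp
  let p : A ⊗[μ.invariants] N →ₗ[μ.invariants] N :=
    TensorProduct.lid μ.invariants N ∘ₗ (Action.invariantForm hρ).rTensor N
  have hp : ∀ b n, p (b ⊗ₜ n) = Action.invariantForm hρ b • n := fun _ _ => rfl
  constructor
  · intro n n' h
    have h1 := congrArg (fun t => p (Subtype.val t)) h
    have h2 : ∀ n, p (Subtype.val (extendUnit.{v} μ N n)) = n := fun n =>
      (hp 1 n).trans (by rw [hf1, one_smul])
    exact (h2 n).symm.trans (h1.trans (h2 n'))
  · rintro ⟨t, ht⟩
    refine ⟨p t, Subtype.ext ?_⟩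
    have h1 := (Action.extend.{v} μ N).contractCoact_of_mem ρ ht
    rw [hρ1, one_smul] at h1
    have h2 : ∀ t : A ⊗[μ.invariants] N, (Action.extend.{v} μ N).contractCoact ρ t =
        (1 : A) ⊗ₜ[μ.invariants] p t := by
      intro t
      induction t using TensorProduct.induction_on with
      | zero => rw [map_zero]; exact (TensorProduct.tmul_zero _ _).symm
      | add x y hx hy =>
        rw [map_add p, TensorProduct.tmul_add, ← hx, ← hy]
        exact map_add _ _ _
      | tmul b n =>
        have h3 := (Action.extend.{v} μ N).contractCoact_smul ρ b (extendUnit.{v} μ N n).2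
        have h4 : (b • (1 : A) ⊗ₜ[μ.invariants] n) = b ⊗ₜ n := by
          rw [TensorProduct.smul_tmul', smul_eq_mul, mul_one]
        rw [hp, ← TensorProduct.smul_tmul, ← h4]
        refine h3.trans ?_
        refine (TensorProduct.smul_tmul' _ _ _).trans ?_
        rfl
    exact (h2 t).symm.trans h1

theorem AGModule.extendCoact_invariantsMul (M : AGModule.{max v u₃} μ)
    (t : A ⊗[μ.invariants] M.invariants) : M.coact (M.invariantsMul t) =
      (M.invariantsMul.restrictScalars k).rTensor R (μ.extendCoact M.invariants t) := by
  induction t using TensorProduct.induction_on with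
  | zero => simp
  | add x y hx hy => simp only [map_add, hx, hy]
  | tmul b m =>
    have hm : M.coact (m : M) = (m : M) ⊗ₜ (1 : R) := m.2
    rw [AGModule.invariantsMul_tmul, M.coact_smul, hm, μ.extendCoact_tmul]
    induction μ.coact b using TensorProduct.induction_on with
    | zero => simp
    | add x y hx hy => simp only [map_add, LinearMap.add_apply, hx, hy]
    | tmul c r => simp

/-- The multiplication `A ⊗_{A^G} M^G → M` as a morphism of `(A, G)`-modules. -/
noncomputable def invariantsMulHom (M : AGModule.{max v u₃} μ) :
    (invariantsFunctor μ ⋙ extensionFunctor.{v} μ).obj M ⟶ M :=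
  AGModule.Hom.mk (M := Action.extend.{v} μ M.invariants) M.invariantsMul
    (LinearMap.ext fun t => AGModule.extendCoact_invariantsMul.{v} M t)

theorem AGModule.isIso_of_bijective {M N : AGModule.{w} μ} (f : M ⟶ N)
    (hf : Function.Bijective (AGModule.Hom.toLinearMap f)) : IsIso f := by
  let e := LinearEquiv.ofBijective (AGModule.Hom.toLinearMap f) hf
  refine ⟨⟨⟨e.symm.toLinearMap, ?_⟩, ?_, ?_⟩⟩
  · refine LinearMap.ext fun n => ?_
    obtain ⟨m, rfl⟩ := e.surjective n
    have h1 : N.coact (e m) = ((e.toLinearMap).restrictScalars k).rTensor R (M.coact m) :=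
      AGModule.Hom.coact_apply f m
    change M.coact (e.symm (e m)) = ((e.symm.toLinearMap).restrictScalars k).rTensor R
      (N.coact (e m))
    rw [h1, ← LinearMap.rTensor_comp_apply, e.symm_apply_apply]
    have h2 : (e.symm.toLinearMap).restrictScalars k ∘ₗ (e.toLinearMap).restrictScalars k =
        LinearMap.id := by
      ext m
      exact e.symm_apply_apply m
    rw [h2, LinearMap.rTensor_id, LinearMap.id_apply]
  · exact AGModule.Hom.ext (LinearMap.ext e.symm_apply_apply)
  · exact AGModule.Hom.ext (LinearMap.ext e.apply_symm_apply)

theorem exists_equivalence {n : ℕ} {a : Fin n → A} {χ : Fin n → R →ₗ[k] A} {ρ : R →ₗ[k] A}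
    (hχ : ∀ i b, contract (χ i) A (μ.coact b) ∈ μ.invariants)
    (hsum : ∀ b, ∑ i, contract (χ i) A (μ.coact b) * a i = b)
    (hρ : ∀ b, contract ρ A (μ.coact b) ∈ μ.invariants) (hρ1 : ρ 1 = 1) :
    ∃ e : (generatedByInvariants.{max v u₃} μ).FullSubcategory ≌
        ModuleCat.{max v u₃} μ.invariants,
      e.functor = invariantsFunctor' μ ∧ e.inverse = extensionFunctor'.{v} μ := by
  have hiso : ∀ M : (generatedByInvariants.{max v u₃} μ).FullSubcategory,
      IsIso (invariantsMulHom.{v} M.obj) := fun M =>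
    AGModule.isIso_of_bijective _ ⟨M.obj.invariantsMul_injective hχ hsum,
      AGModule.invariantsMul_surjective M.property⟩
  let η : invariantsFunctor' μ ⋙ extensionFunctor'.{v} μ ≅
      𝟭 (generatedByInvariants.{max v u₃} μ).FullSubcategory :=
    NatIso.ofComponents
      (fun M => (generatedByInvariants μ).isoMk (@asIso _ _ _ _ _ (hiso M))) (by
        intro M N f
        apply ObjectProperty.hom_ext
        apply AGModule.Hom.ext
        refine LinearMap.ext fun (t : A ⊗[μ.invariants] M.obj.invariants) => ?_
        induction t using TensorProduct.induction_on with
        | zero => exact (map_zero _).trans (map_zero _).symm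
        | add x y hx hy => exact (map_add _ _ _).trans ((congrArg₂ _ hx hy).trans
            (map_add _ _ _).symm)
        | tmul b m => exact (map_smul f.hom.toLinearMap b (m : M.obj)).symm)
  let ε : 𝟭 (ModuleCat.{max v u₃} μ.invariants) ≅
      extensionFunctor'.{v} μ ⋙ invariantsFunctor' μ :=
    NatIso.ofComponents
      (fun N => (LinearEquiv.ofBijective _
        (extendUnit_bijective.{v} hρ hρ1 N)).toModuleIso) (by
        intro M N f
        rfl)
  exact ⟨CategoryTheory.Equivalence.mk _ _ η.symm ε.symm, rfl, rfl⟩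

/-- The dual basis makes `A`, hence `M`, finite projective over `A^G`, and the operator of `ρ`
splits `M^G` off `M`. The rank is read off after base change to `A`, where `A ⊗ M^G ≅ M`. -/
theorem isProjectiveOfRank_invariants {M : AGModule.{w} μ} (hM : generatedByInvariants μ M)
    {n : ℕ} {a : Fin n → A} {χ : Fin n → R →ₗ[k] A} {ρ : R →ₗ[k] A}
    (hχ : ∀ i b, contract (χ i) A (μ.coact b) ∈ μ.invariants)
    (hsum : ∀ b, ∑ i, contract (χ i) A (μ.coact b) * a i = b)
    (hρ : ∀ b, contract ρ A (μ.coact b) ∈ μ.invariants) (hρ1 : ρ 1 = 1) {r : ℕ}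
    (h : IsProjectiveOfRank A M r) : IsProjectiveOfRank μ.invariants M.invariants r := by
  obtain ⟨hfin, hproj, hrank⟩ := h
  let p : (Fin n → μ.invariants) →ₗ[μ.invariants] A := Fintype.linearCombination _ a
  let i : A →ₗ[μ.invariants] (Fin n → μ.invariants) :=
    LinearMap.pi fun j => Action.invariantForm (hχ j)
  have hpi : p ∘ₗ i = LinearMap.id := LinearMap.ext fun b => hsum b
  have hfinA : Module.Finite μ.invariants A := Module.Finite.of_surjective p fun b =>
    ⟨i b, LinearMap.congr_fun hpi b⟩
  have hprojA : Module.Projective μ.invariants A := Module.Projective.of_split i p hpi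
  have hfinM : Module.Finite μ.invariants M := Module.Finite.trans A M
  have hprojM : Module.Projective μ.invariants M := by
    obtain ⟨m, f, g, -, -, hfg⟩ := Module.Finite.exists_comp_eq_id_of_projective A M
    have : Module.Projective μ.invariants (Fin m → A) := Module.Projective.of_equiv
      (M := Π₀ _ : Fin m, A) DFinsupp.linearEquivFunOnFintype
    exact Module.Projective.of_split (g.restrictScalars μ.invariants)
      (f.restrictScalars μ.invariants) (LinearMap.ext fun m => LinearMap.congr_fun hfg m)
  let q : M →ₗ[μ.invariants] M.invariants :=
    { toFun := fun m => ⟨_, AGModule.contractCoact_mem_invariants hM hρ m⟩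
      map_add' := fun m m' => Subtype.ext (map_add _ _ _)
      map_smul' := fun c m => Subtype.ext (M.contractCoact_invariants_smul ρ c m) }
  have hq : q ∘ₗ M.invariants.subtype = LinearMap.id := by
    refine LinearMap.ext fun m => Subtype.ext ?_
    refine (M.contractCoact_of_mem ρ m.2).trans ?_
    rw [hρ1, one_smul]
    rfl
  have hfin' : Module.Finite μ.invariants M.invariants :=
    Module.Finite.of_surjective q fun m => ⟨m, LinearMap.congr_fun hq m⟩
  have hproj' : Module.Projective μ.invariants M.invariants := Module.Projective.of_split _ q hq
  refine ⟨hfin', hproj', fun y => ?_⟩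
  have : FaithfulSMul μ.invariants A :=
    (faithfulSMul_iff_algebraMap_injective _ _).2 Subtype.val_injective
  -- Every prime of `A^G` lies below a prime of `A`, so it suffices to compute ranks on `Spec A`.
  obtain ⟨x, rfl⟩ := Algebra.IsIntegral.comap_surjective μ.invariants A y
  rw [← Module.rankAtStalk_baseChange, Module.rankAtStalk_eq_of_equiv (LinearEquiv.ofBijective _
    ⟨M.invariantsMul_injective hχ hsum, AGModule.invariantsMul_surjective hM⟩), hrank]

end Modules

end GroupSchemeAction

/-! ### Assembly of the theorem. -/

theorem proposition3p2
    {k : Type u₁} [Field k] [IsAlgClosed k]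
    -- the finite group scheme `G = Spec R`
    {R : Type u₂} [CommRing R] [HopfAlgebra k R] [Module.Finite k R]
    -- the irreducible affine variety `X = Spec A`, with an action of `G`
    {A : Type u₃} [CommRing A] [IsDomain A] [Algebra k A] [Algebra.FiniteType k A]
    (μ : Action k R A) (hreg : ∀ x : A →ₐ[k] k, μ.IsRegularPoint x) :
    -- (1) closure under submodules and factor modules
    (∀ (M N : AGModule.{max v u₃} μ) (f : N ⟶ M), Function.Injective f.toLinearMap →
      generatedByInvariants μ M → generatedByInvariants μ N) ∧
    (∀ (M N : AGModule.{max v u₃} μ) (f : M ⟶ N), Function.Surjective f.toLinearMap →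
      generatedByInvariants μ M → generatedByInvariants μ N) ∧
    -- (2) the equivalence of categories
    (∃ e : (generatedByInvariants.{max v u₃} μ).FullSubcategory ≌
        ModuleCat.{max v u₃} μ.invariants,
      e.functor = invariantsFunctor' μ ∧ e.inverse = extensionFunctor'.{v} μ) ∧
    -- (3) preservation of projective modules of rank `r`
    (∀ (M : AGModule.{max v u₃} μ) (r : ℕ), generatedByInvariants μ M →
      IsProjectiveOfRank A M r → IsProjectiveOfRank μ.invariants M.invariants r) := by
  -- If every point attains the maximal index, any two indices bound each other, so all orbit images
  -- have the same dimension.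
  obtain ⟨d, hd⟩ : ∃ d, ∀ y : A →ₐ[k] k, Module.finrank k (μ.orbitMap y).range = d := by
    rcases isEmpty_or_nonempty (A →ₐ[k] k) with h | ⟨⟨x⟩⟩
    · exact ⟨0, fun y => h.elim y⟩
    · refine ⟨index k (μ.stabilizerIdeal x), fun y => ?_⟩
      rw [μ.finrank_range_orbitMap]
      exact le_antisymm (hreg x y) (hreg y x)
  obtain ⟨n, a, χ, ρ, hχ, hρ, hsum, hρ1⟩ := μ.exists_dualBasis hd
  exact ⟨fun M N f hf hM => generatedByInvariants_of_injective f hf hM hχ hsum,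
    fun M N f hf hM => generatedByInvariants_of_surjective f hf hM,
    exists_equivalence.{v} hχ hsum hρ hρ1,
    fun M r hM h => isProjectiveOfRank_invariants hM hχ hsum hρ hρ1 h⟩
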